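/- **Notation.** Let $e_1,\dots,e_n$ be the standard basis of $\mathbb R^n$ and let $$A_{n-1}=\{e_i-e_j: i<j\},\quad D_n=\{e_i-e_j,\ e_i+e_j: i<j\},\quad B_n=D_n\cup\{e_i: 1\le i\le n\},\quad C_n=D_n\cup\{2e_i: 1\le i\le n\}$$ (with $1\le i<j\le n$) be the sets of positive roots of the classical root systems. For such a $\Phi$ let $\Lambda_R=\mathbb Z\Phi$ be its root lattice. For $S\subseteq\Phi$ let $r(S)=\dim\operatorname{span}S$ and let $m(S)$ be the index of $\mathbb ZS$ in $\operatorname{span}S\cap\Lambda_R$. The arithmetic Tutte polynomial of $\Phi$ in its root lattice and the corresponding arithmetic coboundary polynomial are $$M^R_\Phi(x,y)=\sum_{S\subseteq\Phi}m(S)(x-1)^{r(\Phi)-r(S)}(y-1)^{|S|-r(S)},\qquad \psi^R_\Phi(X,Y)=(Y-1)^{r(\Phi)}M^R_\Phi\Big(\tfrac{X+Y-1}{Y-1},\,Y\Big).$$ Define the formal power series in $Z$ $$\Psi^R_A=1+X\sum_{n\ge1}\psi^R_{A_{n-1}}\frac{Z^n}{n!},\quad \Psi^R_B=\sum_{n\ge0}\psi^R_{B_n}\frac{Z^n}{n!},\quad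 \Psi^R_C=\sum_{n\ge0}\psi^R_{C_n}\frac{Z^n}{n!},\quad \Psi^R_D=1+XZ+\sum_{n\ge2}\psi^R_{D_n}\frac{Z^n}{n!},$$ where in type $D$ the term of the degenerate system $D_1=\emptyset$, of rank $0$ in $\mathbb R^1$, is taken with an extra factor $X$, as in type $A$. Let $$F(\alpha,\beta)=\sum_{n\ge0}\frac{\alpha^n\beta^{\binom n2}}{n!},$$ and for a power series $f$ in $Z$ with constant term $1$ and an exponent $a$ let $f^a=\sum_{k\ge0}\binom ak(f-1)^k$. **Theorem.** The arithmetic Tutte generating functions of the classical root systems in their root lattices are $$\begin{aligned} \Psi^R_A&=F(Z,Y)^X,\\ \Psi^R_B&=F(2Z,Y)^{\frac X2-1}F(Z,Y^2)F(YZ,Y^2),\\ \Psi^R_C&=\tfrac12F(2Z,Y)^{\frac X2-1}\left[F(2Z,Y)+F(YZ,Y^2)^2\right],\\ \Psi^R_D&=\tfrac12F(2Z,Y)^{\frac X2-1}\left[F(2Z,Y)+F(Z,Y^2)^2\right], \end{aligned}$$ as identities of formal power series. -/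

import Mathlib

noncomputable section

/-! ### Arithmetic Tutte polynomials -/

section ArithmeticTutte

variable {V : Type*} [AddCommGroup V] [Module ℝ V]

/-- The rank of a finite vector configuration: the dimension of its real span. -/
def configRank (B : Finset V) : ℕ :=
  Module.finrank ℝ (Submodule.span ℝ (B : Set V))

/-- The multiplicity `m(B)` of `B` with respect to the lattice `L`: the index of `ℤB` as a
sublattice of `span B ∩ L`. -/
def latticeMult (L : AddSubgroup V) (B : Finset V) : ℕ :=
  (AddSubgroup.closure (B : Set V)).relIndex
    ((Submodule.span ℝ (B : Set V)).toAddSubgroup ⊓ L)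

/-- The arithmetic Tutte polynomial
`M_A(x,y) = ∑_{B ⊆ A} m(B) (x-1)^{r(A)-r(B)} (y-1)^{|B|-r(B)}` of `A` with respect to the
lattice `L`; the variable `x` is `X 0` and `y` is `X 1`. -/
def arithTutte (L : AddSubgroup V) (A : Finset V) : MvPolynomial (Fin 2) ℤ :=
  ∑ B ∈ A.powerset,
    MvPolynomial.C (latticeMult L B : ℤ)
      * (MvPolynomial.X 0 - 1) ^ (configRank A - configRank B)
      * (MvPolynomial.X 1 - 1) ^ (B.card - configRank B)

end ArithmeticTutte

/-! ### Arithmetic coboundary polynomials -/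

/-- The field `ℚ(X, Y)` of rational functions in the two variables of the coboundary polynomial. -/
abbrev CobField : Type := FractionRing (MvPolynomial (Fin 2) ℚ)

/-- The variable `X`. -/
def cX : CobField := algebraMap (MvPolynomial (Fin 2) ℚ) CobField (MvPolynomial.X 0)

/-- The variable `Y`. -/
def cY : CobField := algebraMap (MvPolynomial (Fin 2) ℚ) CobField (MvPolynomial.X 1)

/-- The arithmetic coboundary polynomial `ψ_A(X,Y) = (y-1)^{r(A)} M_A(x,y)`, where
`x = (X+Y-1)/(Y-1)` and `y = Y`. -/
def arithCoboundary {V : Type*} [AddCommGroup V] [Module ℝ V]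
    (L : AddSubgroup V) (A : Finset V) : CobField :=
  (cY - 1) ^ configRank A
    * MvPolynomial.aeval ![(cX + cY - 1) / (cY - 1), cY] (arithTutte L A)

/-! ### The classical root systems and their root lattices -/

section RootSystems

/-- The standard basis vector `e_i` of `ℝⁿ`. -/
def stdVec {n : ℕ} (i : Fin n) : Fin n → ℝ := Pi.single i 1

/-- The pairs `i < j` of indices. -/
def ltPairs (n : ℕ) : Finset (Fin n × Fin n) := Finset.univ.filter fun p => p.1 < p.2

/-- The positive roots `e_i - e_j` (`i < j`) in `ℝⁿ` of type `A_{n-1}`. -/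
def posRootsA (n : ℕ) : Finset (Fin n → ℝ) :=
  (ltPairs n).image fun p => stdVec p.1 - stdVec p.2

/-- The positive roots `e_i - e_j`, `e_i + e_j` (`i < j`) of type `D_n`. -/
def posRootsD (n : ℕ) : Finset (Fin n → ℝ) :=
  ((ltPairs n).image fun p => stdVec p.1 - stdVec p.2)
    ∪ (ltPairs n).image fun p => stdVec p.1 + stdVec p.2

/-- The positive roots `e_i - e_j`, `e_i + e_j` (`i < j`) and `e_i` of type `B_n`. -/
def posRootsB (n : ℕ) : Finset (Fin n → ℝ) :=
  ((ltPairs n).image fun p => stdVec p.1 - stdVec p.2)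
    ∪ ((ltPairs n).image fun p => stdVec p.1 + stdVec p.2)
    ∪ Finset.univ.image fun i => stdVec i

/-- The positive roots `e_i - e_j`, `e_i + e_j` (`i < j`) and `2 e_i` of type `C_n`. -/
def posRootsC (n : ℕ) : Finset (Fin n → ℝ) :=
  ((ltPairs n).image fun p => stdVec p.1 - stdVec p.2)
    ∪ ((ltPairs n).image fun p => stdVec p.1 + stdVec p.2)
    ∪ Finset.univ.image fun i => (2 : ℝ) • stdVec i

/-- The root lattice of a root system: the subgroup generated by the roots. -/
def rootLattice {n : ℕ} (Φ : Finset (Fin n → ℝ)) : AddSubgroup (Fin n → ℝ) :=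
  AddSubgroup.closure (Φ : Set (Fin n → ℝ))

/-- The arithmetic coboundary polynomial of `Φ` with respect to its root lattice. -/
def rootCoboundary {n : ℕ} (Φ : Finset (Fin n → ℝ)) : CobField :=
  arithCoboundary (rootLattice Φ) Φ

end RootSystems

/-! ### Generating functions: power series in `Z` over `ℚ(X, Y)` -/

/-- `Ψ^R_A = 1 + X ∑_{n ≥ 1} ψ_{A_{n-1}} Zⁿ/n!`. -/
def PsiRA : PowerSeries CobField :=
  1 + PowerSeries.C cX *
    PowerSeries.mk fun n => if n = 0 then 0 else rootCoboundary (posRootsA n) / (n.factorial : CobField)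

/-- `Ψ^R_B = ∑_{n ≥ 0} ψ_{B_n} Zⁿ/n!`. -/
def PsiRB : PowerSeries CobField :=
  PowerSeries.mk fun n => rootCoboundary (posRootsB n) / (n.factorial : CobField)

/-- `Ψ^R_C = ∑_{n ≥ 0} ψ_{C_n} Zⁿ/n!`. -/
def PsiRC : PowerSeries CobField :=
  PowerSeries.mk fun n => rootCoboundary (posRootsC n) / (n.factorial : CobField)

/-- `Ψ^R_D = ∑_{n ≥ 0} ψ_{D_n} Zⁿ/n!`, where the term of the degenerate system `D_1` carries an
extra factor `X`: `D_1 = ∅` has rank `0 = n - 1` inside `ℤ¹`, exactly as `A_{n-1}` has rank `n - 1`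
inside `ℤⁿ`, and in type `A` this factor is part of the definition. For `n ≠ 1` the system `D_n`
has full rank `n`. -/
def PsiRD : PowerSeries CobField :=
  PowerSeries.mk fun n =>
    (if n = 1 then cX else 1) * rootCoboundary (posRootsD n) / (n.factorial : CobField)

/-- The deformed exponential function `F(cZ, β) = ∑_{n ≥ 0} (cZ)ⁿ β^{n choose 2} / n!`, as a power
series in `Z`. -/
def deformedExp (c β : CobField) : PowerSeries CobField :=
  PowerSeries.mk fun n => c ^ n * β ^ n.choose 2 / (n.factorial : CobField)

/-- The power `f ^ a = ∑_k (a choose k) (f - 1)^k` of a power series `f` with constant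
coefficient `1`, for an arbitrary exponent `a` in the coefficient field: the binomial series
`(1 + Z)^a` evaluated at `f - 1`. -/
def seriesPow (f : PowerSeries CobField) (a : CobField) : PowerSeries CobField :=
  PowerSeries.subst (f - 1) (PowerSeries.binomialSeries CobField a)

end

noncomputable section

/-! The proof is the finite field method over `ℤ/m`. For a finite-index lattice `Λ ⊆ ℤⁿ` and `B ⊆
Λ`, the characters of `ℤⁿ` that kill `qΛ` and `B` form the dual of `ℤⁿ/(qΛ + ℤB)`. If `m(B)` divides
`q`, this group has order `[ℤⁿ : Λ] m(B) q^(n - r(B))`. Weighting each character that kills `qΛ` by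
one factor `Y` per root it kills, and expanding `Y = 1 + (Y - 1)`, gives `[ℤⁿ : Λ]` times the
coboundary polynomial at `X = q`, up to a power of `X` for the corank (`sum_prod_zmodPairing`,
`cX_pow_mul_rootCoboundary`).

The same sum counts colourings. A character is a word `x₁ … xₙ` in residues; `e_i - e_j` and `e_i +
e_j` test `x_i = x_j` and `x_i = -x_j`. The exponential formula turns the sum into a product of
deformed exponentials over colours (type A) or over orbits of negation (`sum_involution`): a free
orbit gives `F(2Z, Y)`, a fixed residue `F(vZ, Y²)` with `v` recording the axis root.

For A and B one takes `Λ = ℤⁿ` and `m = q`; for even `q`, negation has 2 fixed residues and `q/2 -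
1` free orbits. For C and D, `Λ` is the even-sum lattice and `m = 2q`; the admissible words have all
letters of one parity. The two parity classes give the two summands, and the index 2 gives the
factor 1/2. Finally, coefficients on both sides are polynomials in `X` that agree at infinitely many
`q` (`countPoly_eval_eq`). -/

/-! ### Indices of the subgroups `qM + N` -/

/-- Saturation makes `M/S` torsion-free, hence free of some rank `r`, and `qM + S` is the kernel of
the surjection `M → M/S ≅ ℤ^r → (ℤ/q)^r`. -/
lemma index_nsmul_range_sup_of_saturated {M : Type*} [AddCommGroup M] [Module.Finite ℤ M]
    (S : AddSubgroup M) (hS : ∀ (k : ℤ) (x : M), k ≠ 0 → k • x ∈ S → x ∈ S)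
    (q : ℕ) [NeZero q] :
    ((nsmulAddMonoidHom q : M →+ M).range ⊔ S).index
      = q ^ Module.finrank ℤ (M ⧸ AddSubgroup.toIntSubmodule S) := by
  set Q := M ⧸ AddSubgroup.toIntSubmodule S
  have htf : Module.IsTorsionFree ℤ Q := by
    refine Module.IsTorsionFree.of_smul_eq_zero fun k y h => ?_
    obtain ⟨x, rfl⟩ := Submodule.Quotient.mk_surjective _ y
    rw [or_iff_not_imp_left]
    intro hk
    rw [← Submodule.Quotient.mk_smul, Submodule.Quotient.mk_eq_zero] at h
    rw [Submodule.Quotient.mk_eq_zero]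
    exact hS k x hk h
  have : Module.Free ℤ Q := inferInstance
  let b := Module.finBasis ℤ Q
  let f : M →+ (Fin (Module.finrank ℤ Q) → ZMod q) :=
    ((Int.castAddHom (ZMod q)).compLeft _).comp
      ((b.equivFun.toLinearMap ∘ₗ (AddSubgroup.toIntSubmodule S).mkQ).toAddMonoidHom)
  have hf : Function.Surjective f := by
    intro y
    obtain ⟨x, hx⟩ := Submodule.Quotient.mk_surjective (AddSubgroup.toIntSubmodule S)
      (b.equivFun.symm fun i => ((y i).cast : ℤ))
    refine ⟨x, ?_⟩
    ext i
    change ((b.equivFun (Submodule.Quotient.mk x) i : ℤ) : ZMod q) = y i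
    rw [hx, LinearEquiv.apply_symm_apply]
    simp
  have hker : f.ker = (nsmulAddMonoidHom q : M →+ M).range ⊔ S := by
    apply le_antisymm
    · intro x hx
      have hx' : ∀ i, (q : ℤ) ∣ b.equivFun (Submodule.Quotient.mk x) i := by
        intro i
        rw [← ZMod.intCast_zmod_eq_zero_iff_dvd]
        exact congrFun hx i
      choose c hc using hx'
      obtain ⟨y, hy⟩ := Submodule.Quotient.mk_surjective (AddSubgroup.toIntSubmodule S)
        (b.equivFun.symm c)
      have hxy : x - q • y ∈ S := by
        have : (Submodule.Quotient.mk (x - q • y) : Q) = 0 := by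
          rw [Submodule.Quotient.mk_sub, sub_eq_zero]
          apply b.equivFun.injective
          ext i
          have : (Submodule.Quotient.mk (q • y) : Q) = q • b.equivFun.symm c := by
            rw [← hy]; rfl
          rw [hc, this, map_nsmul, LinearEquiv.apply_symm_apply]
          simp
        rwa [Submodule.Quotient.mk_eq_zero] at this
      have : x = q • y + (x - q • y) := by abel
      rw [this]
      exact AddSubgroup.add_mem_sup ⟨y, rfl⟩ hxy
    · refine sup_le ?_ ?_
      · rintro _ ⟨y, rfl⟩
        rw [AddMonoidHom.mem_ker]
        simp only [nsmulAddMonoidHom_apply, map_nsmul]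
        ext i
        simp
      · intro x hx
        rw [AddMonoidHom.mem_ker]
        have : (Submodule.Quotient.mk x : Q) = 0 := by
          rwa [Submodule.Quotient.mk_eq_zero]
        ext i
        change ((b.equivFun (Submodule.Quotient.mk x) i : ℤ) : ZMod q) = 0
        rw [this, map_zero]
        simp
  rw [← hker, AddSubgroup.index_ker, AddMonoidHom.range_eq_top.2 hf]
  simp [Q]

/-- Pass through `qM + S`: the remaining factor `[qM + S : qM + N]` equals `[S : N]` because `S ∩
(qM + N) = N`. Indeed `qy ∈ S` forces `y ∈ S` by saturation, and then `qy ∈ N` because `[S : N]`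
divides `q`. -/
lemma index_nsmul_range_sup {M : Type*} [AddCommGroup M] [Module.Finite ℤ M]
    (S N : AddSubgroup M) (hNS : N ≤ S)
    (hS : ∀ (k : ℤ) (x : M), k ≠ 0 → k • x ∈ S → x ∈ S)
    (q : ℕ) [NeZero q] (hq : N.relIndex S ∣ q) :
    ((nsmulAddMonoidHom q : M →+ M).range ⊔ N).index
      = N.relIndex S * q ^ Module.finrank ℤ (M ⧸ AddSubgroup.toIntSubmodule S) := by
  rw [← index_nsmul_range_sup_of_saturated S hS q]
  set R := (nsmulAddMonoidHom q : M →+ M).range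
  have h1 : R ⊔ N ≤ R ⊔ S := sup_le_sup_left hNS _
  rw [← AddSubgroup.relIndex_mul_index h1]
  congr 1
  have h2 : R ⊔ S = S ⊔ (R ⊔ N) := by
    rw [sup_comm R N, ← sup_assoc, sup_eq_left.2 hNS, sup_comm]
  rw [h2, AddSubgroup.relIndex_sup_right, ← AddSubgroup.inf_relIndex_right]
  congr 1
  apply le_antisymm
  · rintro x ⟨hx, hxS⟩
    obtain ⟨_, ⟨y, rfl⟩, z, hz, rfl⟩ := AddSubgroup.mem_sup.1 hx
    refine N.add_mem ?_ hz
    have hy : (q : ℤ) • y ∈ S := by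
      have := S.sub_mem hxS (hNS hz)
      simpa using this
    have hyS := hS q y (by exact_mod_cast NeZero.ne q) hy
    obtain ⟨c, rfl⟩ := hq
    have := (N.addSubgroupOf S).nsmul_index_mem ⟨y, hyS⟩
    rw [AddSubgroup.mem_addSubgroupOf] at this
    have h3 := N.nsmul_mem this c
    simp only [nsmulAddMonoidHom_apply]
    rw [mul_comm, mul_smul]
    exact h3
  · exact le_inf le_sup_right hNS

/-! ### Duality over `ℤ/m` -/

/-- The pairing of an integer vector with a vector over `ℤ/m`, as a homomorphism in the former. -/
def zmodPairing {n m : ℕ} (x : Fin n → ZMod m) : (Fin n → ℤ) →+ ZMod m where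
  toFun h := ∑ i, x i * (h i : ZMod m)
  map_zero' := by simp
  map_add' a b := by simp [mul_add, Finset.sum_add_distrib]

/-- The points counted are the homomorphisms `ℤⁿ/H → ℤ/m`. Since `m` kills the finite group `ℤⁿ/H`,
there are as many of them as elements of the group. -/
lemma card_zmod_annihilator {n : ℕ} (H : AddSubgroup (Fin n → ℤ)) (m : ℕ) [NeZero m]
    (hm : ∀ x : Fin n → ℤ, m • x ∈ H) :
    Nat.card {x : Fin n → ZMod m // ∀ h ∈ H, zmodPairing x h = 0} = H.index := by
  let Q := (Fin n → ℤ) ⧸ H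
  have hQ : ∀ y : Q, m • y = 0 := by
    intro y
    obtain ⟨x, rfl⟩ := QuotientAddGroup.mk_surjective y
    rw [← QuotientAddGroup.mk_nsmul, QuotientAddGroup.eq_zero_iff]
    exact hm x
  have : Module.Finite ℤ Q := Module.Finite.of_surjective
    (QuotientAddGroup.mk' H).toIntLinearMap QuotientAddGroup.mk_surjective
  have : AddGroup.FG Q := by
    rwa [← Module.Finite.iff_addGroup_fg]
  have : Finite Q := AddCommGroup.finite_of_fg_isAddTorsion _
    (fun y => isOfFinAddOrder_iff_nsmul_eq_zero.2 ⟨m, NeZero.pos m, hQ y⟩)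
  -- `ℤ/m` written multiplicatively plays the role of the group of `m`-th roots of unity, with the
  -- class of 1 as primitive root.
  have hroots : HasEnoughRootsOfUnity (Multiplicative (ZMod m)) m := by
    refine ⟨⟨Multiplicative.ofAdd 1, ?_⟩,
      have : IsCyclic (Multiplicative (ZMod m))ˣ :=
        isCyclic_of_surjective (toUnits (G := Multiplicative (ZMod m))) toUnits.surjective
      inferInstance⟩
    rw [IsPrimitiveRoot.iff_orderOf, orderOf_ofAdd_eq_addOrderOf, ZMod.addOrderOf_one]
  have hexp : Monoid.exponent (Multiplicative Q) ∣ m := by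
    apply Monoid.exponent_dvd_of_forall_pow_eq_one
    intro y
    exact congrArg Multiplicative.ofAdd (hQ y.toAdd)
  have := HasEnoughRootsOfUnity.of_dvd (Multiplicative (ZMod m)) hexp
  have hcard := CommGroup.card_monoidHom_of_hasEnoughRootsOfUnity (Multiplicative Q)
    (Multiplicative (ZMod m))
  rw [AddSubgroup.index, ← Nat.card_congr (Multiplicative.ofAdd (α := Q)).symm, ← hcard]
  refine Nat.card_congr (Equiv.trans ?_ ((AddMonoidHom.toMultiplicative (α := Q) (β := ZMod m)).trans
    (MulEquiv.monoidHomCongrRightEquiv (toUnits (G := Multiplicative (ZMod m))))))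
  exact
    { toFun x := QuotientAddGroup.lift H (zmodPairing x.1) x.2
      invFun φ := ⟨fun i => φ (QuotientAddGroup.mk (Pi.single i 1)), fun h hh => by
        have : ∑ i, h i • (Pi.single i 1 : Fin n → ℤ) = h := by
          ext j; simp [Finset.sum_apply, Pi.single_apply]
        calc _ = φ (QuotientAddGroup.mk (∑ i, h i • (Pi.single i 1 : Fin n → ℤ))) := by
              change ∑ i, φ (QuotientAddGroup.mk (Pi.single i 1)) * (h i : ZMod m)
                = (φ.comp (QuotientAddGroup.mk' H)) _
              rw [map_sum]
              refine Finset.sum_congr rfl fun i _ => ?_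
              rw [map_zsmul, zsmul_eq_mul, mul_comm]
              rfl
          _ = 0 := by rw [this, (QuotientAddGroup.eq_zero_iff h).2 hh, map_zero]⟩
      left_inv x := by
        ext i
        change zmodPairing x.1 (Pi.single i 1) = x.1 i
        simp [zmodPairing, Pi.single_apply]
      right_inv φ := by
        apply QuotientAddGroup.addMonoidHom_ext
        apply AddMonoidHom.functions_ext'
        intro i
        ext
        simp [zmodPairing, Pi.single_apply] }

/-! ### Ranks and multiplicities in integer coordinates -/

/-- The inclusion `ℤⁿ → ℝⁿ`. -/
def intVec (n : ℕ) : (Fin n → ℤ) →+ (Fin n → ℝ) := (Int.castAddHom ℝ).compLeft (Fin n)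

@[simp] lemma intVec_apply {n : ℕ} (x : Fin n → ℤ) (i : Fin n) : intVec n x i = x i := rfl

lemma intVec_injective (n : ℕ) : Function.Injective (intVec n) := by
  intro x y h
  ext i
  have := congrFun h i
  simpa using this

/-- The image of `T` is a discrete subgroup of `ℝⁿ`, and generators of a discrete subgroup have the
same rank over `ℤ` as over `ℝ`. -/
lemma finrank_eq_finrank_span_intVec {n : ℕ} (T : AddSubgroup (Fin n → ℤ)) :
    Module.finrank ℤ (AddSubgroup.toIntSubmodule T)
      = Module.finrank ℝ (Submodule.span ℝ (intVec n '' T)) := by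
  set j : (Fin n → ℤ) →ₗ[ℤ] (Fin n → ℝ) := (intVec n).toIntLinearMap
  have hspan : Submodule.span ℤ (intVec n '' T) = (AddSubgroup.toIntSubmodule T).map j := by
    rw [show intVec n '' T = ((AddSubgroup.toIntSubmodule T).map j : Set (Fin n → ℝ)) from rfl,
      Submodule.span_eq]
  have hle : Submodule.span ℤ (intVec n '' T)
      ≤ Submodule.span ℤ (Set.range (Pi.basisFun ℝ (Fin n))) := by
    rw [Submodule.span_le]
    rintro _ ⟨x, -, rfl⟩
    have : intVec n x = ∑ i, x i • Pi.basisFun ℝ (Fin n) i := by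
      ext j
      simp [Finset.sum_apply, Pi.single_apply]
    rw [this]
    exact Submodule.sum_mem _ fun i _ => Submodule.smul_mem _ _
      (Submodule.subset_span (Set.mem_range_self i))
  have hdisc : DiscreteTopology (Submodule.span ℤ (intVec n '' T)) :=
    have hd : DiscreteTopology (Submodule.span ℤ (Set.range (Pi.basisFun ℝ (Fin n)))) :=
      inferInstance
    DiscreteTopology.of_subset hd hle
  have h := Real.finrank_eq_int_finrank_of_discrete hdisc
  rw [Set.finrank, Set.finrank, hspan] at h
  rw [h]
  exact (LinearEquiv.finrank_eq (Submodule.equivMapOfInjective j (intVec_injective n) _))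

/-- The saturation `span B ∩ Λ` of the sublattice `ℤB`, in integer coordinates. -/
def satLattice {n : ℕ} (Λ : AddSubgroup (Fin n → ℤ)) (B : Set (Fin n → ℤ)) :
    AddSubgroup (Fin n → ℤ) :=
  (Submodule.span ℝ (intVec n '' B)).toAddSubgroup.comap (intVec n) ⊓ Λ

/-- The index of `ℤB` in `span B ∩ Λ`. -/
def intMult {n : ℕ} (Λ : AddSubgroup (Fin n → ℤ)) (B : Set (Fin n → ℤ)) : ℕ :=
  (AddSubgroup.closure B).relIndex (satLattice Λ B)

/-- The dimension of the real span of a set of integer vectors. -/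
def intRank {n : ℕ} (B : Set (Fin n → ℤ)) : ℕ :=
  Module.finrank ℝ (Submodule.span ℝ (intVec n '' B))

lemma closure_le_satLattice {n : ℕ} {Λ : AddSubgroup (Fin n → ℤ)} {B : Set (Fin n → ℤ)}
    (hB : B ⊆ Λ) : AddSubgroup.closure B ≤ satLattice Λ B := by
  rw [AddSubgroup.closure_le]
  exact fun b hb => ⟨Submodule.subset_span ⟨b, hb, rfl⟩, hB hb⟩

lemma finrank_satLattice {n : ℕ} {Λ : AddSubgroup (Fin n → ℤ)} {B : Set (Fin n → ℤ)}
    (hB : B ⊆ Λ) :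
    Module.finrank ℤ (AddSubgroup.toIntSubmodule (satLattice Λ B)) = intRank B := by
  rw [finrank_eq_finrank_span_intVec, intRank]
  refine congrArg (fun W : Submodule ℝ (Fin n → ℝ) => Module.finrank ℝ W) (le_antisymm ?_ ?_)
  · rw [Submodule.span_le]
    rintro _ ⟨x, hx, rfl⟩
    exact hx.1
  · exact Submodule.span_mono (Set.image_mono
      (AddSubgroup.subset_closure.trans (closure_le_satLattice hB)))

lemma finrank_closure_eq_intRank {n : ℕ} (B : Set (Fin n → ℤ)) :
    Module.finrank ℤ (AddSubgroup.toIntSubmodule (AddSubgroup.closure B)) = intRank B := by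
  rw [finrank_eq_finrank_span_intVec, intRank]
  refine congrArg (fun W : Submodule ℝ (Fin n → ℝ) => Module.finrank ℝ W) (le_antisymm ?_ ?_)
  · rw [Submodule.span_le]
    have : AddSubgroup.closure B
        ≤ (Submodule.span ℝ (intVec n '' B)).toAddSubgroup.comap (intVec n) := by
      rw [AddSubgroup.closure_le]
      exact fun b hb => Submodule.subset_span ⟨b, hb, rfl⟩
    rintro _ ⟨x, hx, rfl⟩
    exact this hx
  · exact Submodule.span_mono (Set.image_mono AddSubgroup.subset_closure)

lemma finrank_addSubgroupOf {M : Type*} [AddCommGroup M] {T U : AddSubgroup M} (h : T ≤ U) :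
    Module.finrank ℤ (AddSubgroup.toIntSubmodule (T.addSubgroupOf U))
      = Module.finrank ℤ (AddSubgroup.toIntSubmodule T) :=
  (LinearEquiv.finrank_eq (AddSubgroup.addSubgroupOfEquivOfLe h).toIntLinearEquiv)

lemma relIndex_ne_zero_of_finrank_eq {n : ℕ} {T U : AddSubgroup (Fin n → ℤ)} (h : T ≤ U)
    (hr : Module.finrank ℤ (AddSubgroup.toIntSubmodule T)
      = Module.finrank ℤ (AddSubgroup.toIntSubmodule U)) : T.relIndex U ≠ 0 := by
  have : Module.Free ℤ U := inferInstanceAs (Module.Free ℤ (AddSubgroup.toIntSubmodule U))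
  have : Module.Finite ℤ U := inferInstanceAs (Module.Finite ℤ (AddSubgroup.toIntSubmodule U))
  have hfin := (Submodule.finiteQuotient_iff (M := U)
    (AddSubgroup.toIntSubmodule (T.addSubgroupOf U))).2 ((finrank_addSubgroupOf h).trans hr)
  have : Finite (U ⧸ T.addSubgroupOf U) := hfin
  exact AddSubgroup.index_ne_zero_of_finite

/-- `ℤB` and its saturation have equal rank, so the index is finite. This excludes the default value
0 of `relIndex`, so that nonzero `q` divisible by every multiplicity exist. -/
lemma intMult_ne_zero {n : ℕ} {Λ : AddSubgroup (Fin n → ℤ)} {B : Set (Fin n → ℤ)}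
    (hB : B ⊆ Λ) : intMult Λ B ≠ 0 :=
  relIndex_ne_zero_of_finrank_eq (closure_le_satLattice hB)
    ((finrank_closure_eq_intRank B).trans (finrank_satLattice hB).symm)

lemma finrank_of_finiteIndex {n : ℕ} (Λ : AddSubgroup (Fin n → ℤ)) [Λ.FiniteIndex] :
    Module.finrank ℤ Λ = n := by
  have : Finite ((Fin n → ℤ) ⧸ AddSubgroup.toIntSubmodule Λ) :=
    inferInstanceAs (Finite ((Fin n → ℤ) ⧸ Λ))
  exact ((Submodule.finiteQuotient_iff (AddSubgroup.toIntSubmodule Λ)).1 this).trans (by simp)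

/-- This is `index_nsmul_range_sup` inside `Λ`, with the saturation of `ℤB` as `S`; returning to
`ℤⁿ` costs the factor `Λ.index`. -/
lemma index_map_nsmul_sup_closure {n : ℕ} {Λ : AddSubgroup (Fin n → ℤ)} [Λ.FiniteIndex]
    {B : Set (Fin n → ℤ)} (hB : B ⊆ Λ) (q : ℕ) [NeZero q] (hq : intMult Λ B ∣ q) :
    (Λ.map (nsmulAddMonoidHom q) ⊔ AddSubgroup.closure B).index
      = Λ.index * (intMult Λ B * q ^ (n - intRank B)) := by
  have : Module.Finite ℤ Λ := inferInstanceAs (Module.Finite ℤ (AddSubgroup.toIntSubmodule Λ))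
  have hNS := closure_le_satLattice hB
  have hS : satLattice Λ B ≤ Λ := inf_le_right
  have hN : AddSubgroup.closure B ≤ Λ := hNS.trans hS
  have hrel : ((AddSubgroup.closure B).addSubgroupOf Λ).relIndex
      ((satLattice Λ B).addSubgroupOf Λ) = intMult Λ B := AddSubgroup.relIndex_addSubgroupOf hS
  have key := index_nsmul_range_sup ((satLattice Λ B).addSubgroupOf Λ)
    ((AddSubgroup.closure B).addSubgroupOf Λ) (fun x hx => hNS hx) (by
      rintro k ⟨x, hx⟩ hk ⟨hkx, -⟩
      refine ⟨?_, hx⟩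
      have h1 : intVec n (k • x) ∈ Submodule.span ℝ (intVec n '' B) := hkx
      rw [map_zsmul, ← Int.cast_smul_eq_zsmul ℝ,
        Submodule.smul_mem_iff _ (Int.cast_ne_zero.2 hk)] at h1
      exact h1) q (hrel ▸ hq)
  have hrank : Module.finrank ℤ
      (Λ ⧸ AddSubgroup.toIntSubmodule ((satLattice Λ B).addSubgroupOf Λ)) = n - intRank B := by
    have h1 := Submodule.finrank_quotient_add_finrank
      (AddSubgroup.toIntSubmodule ((satLattice Λ B).addSubgroupOf Λ))
    rw [finrank_addSubgroupOf hS, finrank_satLattice hB, finrank_of_finiteIndex] at h1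
    omega
  have hmap : Λ.map (nsmulAddMonoidHom q) ⊔ AddSubgroup.closure B
      = ((nsmulAddMonoidHom q : Λ →+ Λ).range ⊔ (AddSubgroup.closure B).addSubgroupOf Λ).map
        Λ.subtype := by
    rw [AddSubgroup.map_sup, AddSubgroup.addSubgroupOf_map_subtype, inf_eq_left.2 hN]
    congr 1
    ext x
    constructor
    · rintro ⟨l, hl, rfl⟩
      exact ⟨q • ⟨l, hl⟩, ⟨⟨l, hl⟩, rfl⟩, rfl⟩
    · rintro ⟨_, ⟨l, rfl⟩, rfl⟩
      exact ⟨l, l.2, rfl⟩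
  rw [hmap, AddSubgroup.index_map_subtype, key, hrel, hrank, mul_comm]

/-! ### The finite field method -/

/-- The polynomial `∑_{B ⊆ A} m(B) (y-1)^{|B|} T^{n - r(B)}`. -/
def countPoly {K : Type*} [Field K] {n : ℕ} (Λ : AddSubgroup (Fin n → ℤ))
    (A : Finset (Fin n → ℤ)) (y : K) : Polynomial K :=
  ∑ B ∈ A.powerset, Polynomial.C ((intMult Λ B : K) * (y - 1) ^ B.card)
    * Polynomial.X ^ (n - intRank (B : Set (Fin n → ℤ)))

open Classical in
/-- The finite field method: the weighted count of the points of a finite torus by the number of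
hypersurfaces through them is a value of the coboundary polynomial. -/
lemma sum_prod_zmodPairing {K : Type*} [Field K] {n : ℕ} (Λ : AddSubgroup (Fin n → ℤ))
    [Λ.FiniteIndex] (A : Finset (Fin n → ℤ)) (hA : ∀ a ∈ A, a ∈ Λ) (y : K)
    (m q : ℕ) [NeZero m] [NeZero q] (hm : ∀ x : Fin n → ℤ, m • x ∈ Λ.map (nsmulAddMonoidHom q))
    (hq : ∀ B ∈ A.powerset, intMult Λ (B : Set (Fin n → ℤ)) ∣ q) :
    ∑ x : Fin n → ZMod m, (if Λ.map (nsmulAddMonoidHom q) ≤ (zmodPairing x).ker then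
        ∏ a ∈ A, (if zmodPairing x a = 0 then y else 1) else 0)
      = Λ.index * (countPoly Λ A y).eval (q : K) := by
  -- Expanding each weight `y` as `1 + (y - 1)` turns the product into a sum over the subsets `B`
  -- that `x` kills.
  have h1 (x : Fin n → ZMod m) : ∏ a ∈ A, (if zmodPairing x a = 0 then y else 1)
      = ∑ B ∈ A.powerset, if ∀ b ∈ B, zmodPairing x b = 0 then (y - 1) ^ B.card else 0 := by
    calc _ = ∏ a ∈ A, (1 + if zmodPairing x a = 0 then y - 1 else 0) := by
          refine Finset.prod_congr rfl fun a _ => ?_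
          split_ifs <;> ring
      _ = _ := by
          rw [Finset.prod_one_add]
          refine Finset.sum_congr rfl fun B _ => ?_
          rw [Finset.prod_ite_zero, Finset.prod_const]
  have h2 (x : Fin n → ZMod m) (B : Finset (Fin n → ℤ)) :
      (if Λ.map (nsmulAddMonoidHom q) ≤ (zmodPairing x).ker then
        (if ∀ b ∈ B, zmodPairing x b = 0 then (y - 1) ^ B.card else 0) else 0)
      = if ∀ h ∈ Λ.map (nsmulAddMonoidHom q) ⊔ AddSubgroup.closure B, zmodPairing x h = 0
        then (y - 1) ^ B.card else 0 := by
    rw [← ite_and]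
    congr 1
    rw [eq_iff_iff]
    change _ ↔ Λ.map (nsmulAddMonoidHom q) ⊔ AddSubgroup.closure B ≤ (zmodPairing x).ker
    rw [sup_le_iff, AddSubgroup.closure_le]
    rfl
  have h3 (x : Fin n → ZMod m) : (if Λ.map (nsmulAddMonoidHom q) ≤ (zmodPairing x).ker then
        ∏ a ∈ A, (if zmodPairing x a = 0 then y else 1) else 0)
      = ∑ B ∈ A.powerset, if ∀ h ∈ Λ.map (nsmulAddMonoidHom q) ⊔ AddSubgroup.closure B,
          zmodPairing x h = 0 then (y - 1) ^ B.card else 0 := by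
    rw [h1, ← Finset.sum_congr rfl fun B _ => h2 x B]
    split_ifs <;> simp
  rw [Finset.sum_congr rfl fun x _ => h3 x, Finset.sum_comm, countPoly, Polynomial.eval_finsetSum,
    Finset.mul_sum]
  refine Finset.sum_congr rfl fun B hB => ?_
  rw [← Finset.sum_filter, Finset.sum_const, nsmul_eq_mul]
  have hB' : (B : Set (Fin n → ℤ)) ⊆ Λ := fun b hb => hA b (Finset.mem_powerset.1 hB hb)
  have := card_zmod_annihilator (Λ.map (nsmulAddMonoidHom q) ⊔ AddSubgroup.closure B) m
    (fun x => (le_sup_left : Λ.map (nsmulAddMonoidHom q) ≤ _) (hm x))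
  rw [index_map_nsmul_sup_closure hB' q (hq B hB), Nat.card_eq_fintype_card,
    Fintype.card_subtype] at this
  rw [this]
  simp
  ring

/-- Under the substitution `x - 1 = X/(Y - 1)`, the powers of `Y - 1` in the term of `B` combine to
the exponent `r(A) - (r(A) - r(B)) + (|B| - r(B)) = |B|`. -/
lemma arithCoboundary_eq {V : Type*} [AddCommGroup V] [Module ℝ V]
    (L : AddSubgroup V) (A : Finset V) :
    arithCoboundary L A = ∑ B ∈ A.powerset, (latticeMult L B : CobField)
      * cX ^ (configRank A - configRank B) * (cY - 1) ^ B.card := by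
  have hY : cY - 1 ≠ 0 := by
    rw [sub_ne_zero, cY, ← map_one (algebraMap (MvPolynomial (Fin 2) ℚ) CobField)]
    intro h
    have := IsFractionRing.injective (MvPolynomial (Fin 2) ℚ) CobField h
    have := congrArg (MvPolynomial.eval 0) this
    simp at this
  rw [arithCoboundary, arithTutte, map_sum, Finset.mul_sum]
  refine Finset.sum_congr rfl fun B hB => ?_
  have h1 : configRank B ≤ configRank A := Submodule.finrank_mono
    (Submodule.span_mono (Finset.coe_subset.2 (Finset.mem_powerset.1 hB)))
  have h2 : configRank B ≤ B.card := finrank_span_finset_le_card B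
  obtain ⟨c, hc⟩ := Nat.exists_eq_add_of_le h1
  obtain ⟨d, hd⟩ := Nat.exists_eq_add_of_le h2
  rw [hc, hd]
  simp only [map_mul, map_pow, map_sub, map_one, MvPolynomial.aeval_X, Nat.add_sub_cancel_left,
    Matrix.cons_val_zero, Matrix.cons_val_one]
  have : (cX + cY - 1) / (cY - 1) - 1 = cX / (cY - 1) := by
    field_simp
    ring
  rw [this, div_pow]
  simp only [MvPolynomial.aeval_C]
  field_simp
  simp
  ring

-- The multiplicities only see the part of the lattice inside the span of `Φ`, so `Λ` may be larger
-- than the root lattice. The corank of `Φ` in `ℝⁿ` accounts for the power of `cX`; this is the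
-- source of the extra `X` in type A and for `D_1`.
open Classical in
lemma cX_pow_mul_rootCoboundary {n : ℕ} (Λ : AddSubgroup (Fin n → ℤ)) (A : Finset (Fin n → ℤ))
    (Φ : Finset (Fin n → ℝ)) (hΦ : Φ = A.image (intVec n))
    (hΛ : ∀ v ∈ Submodule.span ℝ (Φ : Set (Fin n → ℝ)), v ∈ rootLattice Φ ↔ v ∈ Λ.map (intVec n)) :
    cX ^ (n - configRank Φ) * rootCoboundary Φ = (countPoly Λ A cY).eval cX := by
  have hmap (B : Set (Fin n → ℤ)) (v : Fin n → ℝ) :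
      v ∈ (satLattice Λ B).map (intVec n)
        ↔ v ∈ Submodule.span ℝ (intVec n '' B) ∧ v ∈ Λ.map (intVec n) := by
    constructor
    · rintro ⟨x, ⟨h1, h2⟩, rfl⟩
      exact ⟨h1, x, h2, rfl⟩
    · rintro ⟨h1, x, h2, rfl⟩
      exact ⟨x, ⟨h1, h2⟩, rfl⟩
  rw [rootCoboundary, arithCoboundary_eq, countPoly, Polynomial.eval_finsetSum, Finset.mul_sum]
  subst hΦ
  rw [Finset.powerset_image, Finset.sum_image
    ((Finset.image_injective (intVec_injective n)).injOn)]
  refine Finset.sum_congr rfl fun B hB => ?_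
  have hrank : configRank (B.image (intVec n)) = intRank (B : Set (Fin n → ℤ)) := by
    rw [configRank, intRank, Finset.coe_image]
  have hBA : B.image (intVec n) ⊆ A.image (intVec n) :=
    Finset.image_subset_image (Finset.mem_powerset.1 hB)
  have hmult : latticeMult (rootLattice (A.image (intVec n))) (B.image (intVec n))
      = intMult Λ (B : Set (Fin n → ℤ)) := by
    rw [latticeMult, intMult, ← AddSubgroup.relIndex_map_map_of_injective _ _ (intVec_injective n),
      AddMonoidHom.map_closure, Finset.coe_image]
    congr 1
    ext v
    rw [hmap]
    refine and_congr_right fun hv => hΛ v (Submodule.span_mono ?_ hv)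
    rw [← Finset.coe_image]
    exact Finset.coe_subset.2 hBA
  have h1 : configRank (B.image (intVec n)) ≤ configRank (A.image (intVec n)) :=
    Submodule.finrank_mono (Submodule.span_mono (Finset.coe_subset.2 hBA))
  have h2 : configRank (A.image (intVec n)) ≤ n :=
    (Submodule.finrank_le _).trans (by simp)
  rw [hmult, Finset.card_image_of_injective _ (intVec_injective n)]
  rw [hrank] at h1 ⊢
  have h3 : n - intRank (B : Set (Fin n → ℤ)) = (n - configRank (A.image (intVec n)))
      + (configRank (A.image (intVec n)) - intRank (B : Set (Fin n → ℤ))) := by omega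
  rw [h3, pow_add]
  simp
  ring

/-! ### Colourings and exponential generating functions -/

lemma card_filter_lt_eq_choose {n : ℕ} (T : Finset (Fin n)) :
    ((ltPairs n).filter fun p => p.1 ∈ T ∧ p.2 ∈ T).card = T.card.choose 2 := by
  have h1 : T.offDiag = ((ltPairs n).filter fun p => p.1 ∈ T ∧ p.2 ∈ T)
      ∪ ((ltPairs n).filter fun p => p.1 ∈ T ∧ p.2 ∈ T).image Prod.swap := by
    ext ⟨i, j⟩
    simp only [Finset.mem_offDiag, ltPairs, Finset.mem_union, Finset.mem_filter, Finset.mem_univ,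
      true_and, Finset.mem_image, Prod.exists, Prod.swap_prod_mk, Prod.mk.injEq]
    constructor
    · rintro ⟨hi, hj, hij⟩
      rcases lt_or_gt_of_ne hij with h | h
      · exact Or.inl ⟨h, hi, hj⟩
      · exact Or.inr ⟨j, i, ⟨h, hj, hi⟩, rfl, rfl⟩
    · rintro (⟨h, hi, hj⟩ | ⟨a, b, ⟨h, ha, hb⟩, rfl, rfl⟩)
      · exact ⟨hi, hj, h.ne⟩
      · exact ⟨hb, ha, h.ne'⟩
  have h2 := congrArg Finset.card h1
  rw [Finset.offDiag_card, Finset.card_union_of_disjoint,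
    Finset.card_image_of_injective _ Prod.swap_injective] at h2
  · rw [Nat.choose_two_right, Nat.mul_sub, mul_one, h2]
    omega
  · rw [Finset.disjoint_left]
    rintro ⟨i, j⟩ h h'
    simp only [ltPairs, Finset.mem_filter, Finset.mem_univ,
      true_and, Finset.mem_image, Prod.exists, Prod.swap_prod_mk, Prod.mk.injEq] at h h'
    obtain ⟨a, b, ⟨hab, -⟩, rfl, rfl⟩ := h'
    exact lt_asymm hab h.1

lemma prod_ltPairs_eq_prod_pow_choose {K I : Type*} [CommMonoid K] [Fintype I] [DecidableEq I]
    {n : ℕ} (c : Fin n → I) (t : I → K) :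
    ∏ p ∈ ltPairs n, (if c p.1 = c p.2 then t (c p.1) else 1)
      = ∏ o, t o ^ (Finset.univ.filter fun i => c i = o).card.choose 2 := by
  rw [← Finset.prod_filter, ← Finset.prod_fiberwise _ fun p : Fin n × Fin n => c p.1]
  refine Finset.prod_congr rfl fun o _ => ?_
  rw [← card_filter_lt_eq_choose, ← Finset.prod_const, Finset.filter_filter]
  refine Finset.prod_congr ?_ ?_
  · ext p
    simp only [Finset.mem_filter, Finset.mem_univ, true_and]
    refine and_congr_right fun _ => ⟨?_, ?_⟩
    · rintro ⟨h1, rfl⟩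
      exact ⟨rfl, h1.symm⟩
    · rintro ⟨h1, h2⟩
      exact ⟨h1.trans h2.symm, h1⟩
  · intro p hp
    simp only [Finset.mem_filter] at hp
    rw [hp.2.1.2]

/-- The exponential formula: a product of exponential generating functions counts colourings. -/
lemma factorial_mul_coeff_prod {K I : Type*} [Field K] [CharZero K] [Fintype I] [DecidableEq I]
    (w : I → ℕ → K) (n : ℕ) :
    (n.factorial : K) * PowerSeries.coeff n
        (∏ i, PowerSeries.mk fun k => w i k / (k.factorial : K))
      = ∑ c : Fin n → I, ∏ i, w i (Finset.univ.filter fun j => c j = i).card := by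
  -- The linear functional `X^s ↦ ∏ w_i(s_i)` is applied to two expansions of `(∑ X_i)^n`: by
  -- multinomial coefficients, and by words of length `n`, that is, colourings.
  let φ : MvPolynomial I K →ₗ[K] K :=
    (MvPolynomial.basisMonomials I K).constr K fun s => ∏ i, w i (s i)
  have hφ (s : I →₀ ℕ) : φ (MvPolynomial.monomial s 1) = ∏ i, w i (s i) := by
    have := (MvPolynomial.basisMonomials I K).constr_basis K (fun s => ∏ i, w i (s i)) s
    rwa [MvPolynomial.coe_basisMonomials] at this
  have h1 := Fintype.sum_pow (fun i : I => (MvPolynomial.X i : MvPolynomial I K)) n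
  rw [Finset.sum_pow_eq_sum_piAntidiag] at h1
  have h2 := congrArg φ h1
  rw [map_sum, map_sum] at h2
  have h3 (c : Fin n → I) : φ (∏ j, MvPolynomial.X (c j))
      = ∏ i, w i (Finset.univ.filter fun j => c j = i).card := by
    have : ∏ j, (MvPolynomial.X (c j) : MvPolynomial I K)
        = MvPolynomial.monomial (∑ j, Finsupp.single (c j) 1) 1 := by
      rw [MvPolynomial.monomial_sum_one]
      rfl
    rw [this, hφ]
    refine Finset.prod_congr rfl fun i _ => ?_
    rw [Finsupp.finsetSum_apply, Finset.card_filter]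
    simp [Finsupp.single_apply]
  rw [Finset.sum_congr rfl fun c _ => h3 c] at h2
  rw [← h2, PowerSeries.coeff_prod, Finset.mul_sum]
  refine Finset.sum_nbij' (fun s => ⇑s) (fun k => Finsupp.equivFunOnFinite.symm k) ?_ ?_ ?_ ?_ ?_
  · intro s hs
    rw [Finset.mem_finsuppAntidiag] at hs
    rw [Finset.mem_piAntidiag]
    exact ⟨hs.1, fun _ _ => Finset.mem_univ _⟩
  · intro k hk
    rw [Finset.mem_piAntidiag] at hk
    rw [Finset.mem_finsuppAntidiag]
    exact ⟨hk.1, Finset.subset_univ _⟩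
  · intro s _
    ext; rfl
  · intro k _
    rfl
  · intro s hs
    rw [Finset.mem_finsuppAntidiag] at hs
    have hm : ∏ i, (MvPolynomial.X i : MvPolynomial I K) ^ s i = MvPolynomial.monomial s 1 := by
      rw [MvPolynomial.monomial_eq, Finsupp.prod_fintype]
      · simp
      · simp
    have hmul := Nat.multinomial_spec Finset.univ s
    rw [show (∑ i, s i) = n from hs.1] at hmul
    have h4 : φ ((Nat.multinomial Finset.univ s : MvPolynomial I K)
        * MvPolynomial.monomial s 1) = (Nat.multinomial Finset.univ s : K) * ∏ i, w i (s i) := by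
      rw [← nsmul_eq_mul, map_nsmul, hφ, nsmul_eq_mul]
    rw [hm, h4, ← hmul]
    simp only [PowerSeries.coeff_mk]
    rw [Finset.prod_div_distrib]
    have : ∏ i, ((s i).factorial : K) ≠ 0 :=
      Finset.prod_ne_zero_iff.2 fun i _ => Nat.cast_ne_zero.2 (Nat.factorial_ne_zero _)
    push_cast
    field_simp

lemma factorial_mul_coeff_prod_deformedExp {I : Type*} [Fintype I] [DecidableEq I]
    (a t : I → CobField) (n : ℕ) :
    (n.factorial : CobField) * PowerSeries.coeff n (∏ i, deformedExp (a i) (t i))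
      = ∑ c : Fin n → I, (∏ j, a (c j))
        * ∏ p ∈ ltPairs n, (if c p.1 = c p.2 then t (c p.1) else 1) := by
  have := factorial_mul_coeff_prod (fun i k => a i ^ k * t i ^ k.choose 2) n
  unfold deformedExp
  rw [this]
  refine Finset.sum_congr rfl fun c _ => ?_
  rw [prod_ltPairs_eq_prod_pow_choose, Finset.prod_mul_distrib]
  congr 1
  rw [← Finset.prod_fiberwise _ c]
  refine Finset.prod_congr rfl fun o _ => ?_
  rw [← Finset.prod_const]
  refine Finset.prod_congr rfl fun j hj => ?_
  rw [(Finset.mem_filter.1 hj).2]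

lemma sum_comp_eq_sum_prod_card {G I K : Type*} [Fintype G] [Fintype I] [DecidableEq I]
    [CommSemiring K] {n : ℕ} (π : G → I) (W : (Fin n → I) → K) :
    ∑ x : Fin n → G, W (π ∘ x)
      = ∑ c, (∏ j, ((Finset.univ.filter fun g => π g = c j).card : K)) * W c := by
  rw [← Finset.sum_fiberwise _ fun x : Fin n → G => π ∘ x]
  refine Finset.sum_congr rfl fun c _ => ?_
  rw [← Nat.cast_prod, ← Fintype.card_piFinset, ← nsmul_eq_mul, ← Finset.sum_const]
  refine Finset.sum_congr ?_ ?_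
  · ext x
    simp [funext_iff]
  · intro x hx
    have : π ∘ x = c := by
      ext i
      exact (Finset.mem_filter.1 ((Fintype.mem_piFinset.1 hx) i)).2
    rw [this]

/-- Signed colourings, counted by the orbits of an involution `σ` on the colours. -/
lemma sum_involution {G : Type*} [Fintype G] [DecidableEq G] (σ : G → G)
    (hσ : Function.Involutive σ) (v : G → CobField) (hv : ∀ g, σ g ≠ g → v g = 1)
    (y : CobField) (k : ℕ) (hk : (Finset.univ.filter fun g => σ g ≠ g).card = 2 * k) (n : ℕ) :
    ∑ x : Fin n → G, (∏ p ∈ ltPairs n, (if x p.1 = x p.2 then y else 1)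
        * (if x p.1 = σ (x p.2) then y else 1)) * ∏ i, v (x i)
      = (n.factorial : CobField) * PowerSeries.coeff n (deformedExp 2 y ^ k
        * ∏ g ∈ Finset.univ.filter (fun g => σ g = g), deformedExp (v g) (y ^ 2)) := by
  classical
  let s : Setoid G :=
    { r a b := a = b ∨ a = σ b
      iseqv :=
        { refl a := Or.inl rfl
          symm := by
            rintro a b (rfl | rfl)
            · exact Or.inl rfl
            · exact Or.inr (hσ b).symm
          trans := by
            rintro a b c (rfl | rfl) (rfl | rfl)
            · exact Or.inl rfl
            · exact Or.inr rfl
            · exact Or.inr rfl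
            · exact Or.inl (hσ c) } }
  let π : G → Quotient s := Quotient.mk s
  have hπ (a b : G) : π a = π b ↔ a = b ∨ a = σ b := Quotient.eq
  let r : Quotient s → G := Quotient.out
  have hr (o : Quotient s) : π (r o) = o := Quotient.out_eq o
  have hrg (g : G) : r (π g) = g ∨ r (π g) = σ g := (hπ _ _).1 (hr (π g))
  have hfix (g : G) : σ (r (π g)) = r (π g) ↔ σ g = g := by
    rcases hrg g with h | h
    · rw [h]
    · rw [h, hσ]
      exact eq_comm
  have hvr (g : G) : v (r (π g)) = v g := by
    by_cases hg : σ g = g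
    · rcases hrg g with h | h
      · rw [h]
      · rw [h, hg]
    · rw [hv g hg, hv]
      rwa [Ne, hfix]
  -- Two positions with colours in a common orbit satisfy exactly one of `x = x'`, `x = σ x'` if the
  -- orbit is free, and both if it is a fixed point. Hence the pair weights `y` and `y²`.
  let t : Quotient s → CobField := fun o => if σ (r o) = r o then y ^ 2 else y
  let W : (Fin n → Quotient s) → CobField := fun c =>
    (∏ p ∈ ltPairs n, (if c p.1 = c p.2 then t (c p.1) else 1)) * ∏ i, v (r (c i))
  have hW (x : Fin n → G) : (∏ p ∈ ltPairs n, (if x p.1 = x p.2 then y else 1)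
        * (if x p.1 = σ (x p.2) then y else 1)) * ∏ i, v (x i) = W (π ∘ x) := by
    simp only [W, Function.comp_apply, hvr, t, hfix, hπ]
    congr 1
    refine Finset.prod_congr rfl fun p _ => ?_
    by_cases h1 : x p.1 = x p.2
    · rw [h1]
      by_cases h2 : σ (x p.2) = x p.2
      · simp [h2, pow_two]
      · simp [h2, Ne.symm h2]
    · by_cases h2 : x p.1 = σ (x p.2)
      · have h3 : σ (x p.1) ≠ x p.1 := by
          intro h
          apply h1
          rw [← h, h2, hσ]
        simp [h1, ← h2, h3]
      · simp [h1, h2]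
  have hcard (o : Quotient s) : (Finset.univ.filter fun g => π g = o).card
      = if σ (r o) = r o then 1 else 2 := by
    have : (Finset.univ.filter fun g => π g = o) = {r o, σ (r o)} := by
      ext g
      conv_lhs => rw [← hr o]
      simp [hπ]
    rw [this]
    split_ifs with h
    · simp [h]
    · exact Finset.card_pair (Ne.symm h)
  -- Weight of one position: a free orbit offers two colours of weight 1, a fixed point one colour
  -- of weight `v`.
  let a : Quotient s → CobField := fun o => if σ (r o) = r o then v (r o) else 2
  have hprod : ∏ o, deformedExp (a o) (t o) = deformedExp 2 y ^ k
        * ∏ g ∈ Finset.univ.filter (fun g => σ g = g), deformedExp (v g) (y ^ 2) := by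
    rw [← Finset.prod_filter_mul_prod_filter_not Finset.univ (fun o => σ (r o) = r o), mul_comm]
    congr 1
    · have h1 : (Finset.univ.filter fun o => ¬ σ (r o) = r o).card = k := by
        have := Finset.card_eq_sum_card_fiberwise (f := π)
          (s := Finset.univ.filter fun g => σ g ≠ g)
          (t := Finset.univ.filter fun o => ¬ σ (r o) = r o) (by
            intro g hg
            simpa [hfix] using hg)
        rw [hk, Finset.sum_congr rfl (g := fun _ => 2), Finset.sum_const, smul_eq_mul] at this
        · omega
        · intro o ho
          have ho' : ¬ σ (r o) = r o := (Finset.mem_filter.1 ho).2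
          rw [Finset.filter_filter]
          have h2 := hcard o
          rw [if_neg ho'] at h2
          rw [← h2]
          congr 1
          ext g
          simp only [Finset.mem_filter, Finset.mem_univ, true_and, and_iff_right_iff_imp]
          rintro rfl
          rwa [hfix] at ho'
      rw [Finset.prod_congr rfl (g := fun _ => deformedExp 2 y), Finset.prod_const, h1]
      intro o ho
      have ho' : ¬ σ (r o) = r o := (Finset.mem_filter.1 ho).2
      simp [a, t, ho']
    · refine Finset.prod_nbij' r π ?_ ?_ ?_ ?_ ?_
      · intro o ho
        simpa using ho
      · intro g hg
        simpa [hfix] using hg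
      · intro o _
        exact hr o
      · intro g hg
        have hg' : σ g = g := by simpa using hg
        rcases hrg g with h | h
        · exact h
        · rw [h, hg']
      · intro o ho
        have ho' : σ (r o) = r o := by simpa using ho
        simp [a, t, ho']
  rw [Finset.sum_congr rfl fun x _ => hW x, sum_comp_eq_sum_prod_card, ← hprod,
    factorial_mul_coeff_prod_deformedExp]
  refine Finset.sum_congr rfl fun c _ => ?_
  simp only [W]
  rw [mul_comm (∏ p ∈ ltPairs n, _), ← mul_assoc, ← Finset.prod_mul_distrib]
  congr 1
  refine Finset.prod_congr rfl fun j _ => ?_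
  rw [hcard]
  simp only [a]
  split_ifs with h
  · simp
  · simp [hv _ h]

/-! ### Polynomial dependence on the exponent -/

lemma seriesPow_natCast (f : PowerSeries CobField) (hf : PowerSeries.constantCoeff f = 1) (k : ℕ) :
    seriesPow f k = f ^ k := by
  have hs : PowerSeries.HasSubst (f - 1) :=
    PowerSeries.HasSubst.of_constantCoeff_zero' (by simp [hf])
  rw [seriesPow, PowerSeries.binomialSeries_nat, ← PowerSeries.coe_substAlgHom hs, map_pow, map_add,
    map_one, PowerSeries.substAlgHom_X, add_sub_cancel]

lemma exists_polynomial_choose (d : ℕ) :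
    ∃ P : Polynomial CobField, ∀ a, P.eval a = Ring.choose a d := by
  refine ⟨Polynomial.C ((d.factorial : CobField)⁻¹)
    * (descPochhammer ℤ d).map (Int.castRingHom CobField), fun a => ?_⟩
  have h := Ring.descPochhammer_eq_factorial_smul_choose a d
  have hd : (d.factorial : CobField) ≠ 0 := Nat.cast_ne_zero.2 (Nat.factorial_ne_zero _)
  have h' : (descPochhammer ℤ d).smeval a
      = ((descPochhammer ℤ d).map (Int.castRingHom CobField)).eval a := by
    rw [Polynomial.smeval_eq_sum, Polynomial.eval_map, Polynomial.eval₂_eq_sum]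
    refine Finset.sum_congr rfl fun e _ => ?_
    simp [Polynomial.smul_pow]
  rw [h', nsmul_eq_mul] at h
  rw [Polynomial.eval_mul, Polynomial.eval_C, inv_mul_eq_iff_eq_mul₀ hd]
  exact h

/-- `(f - 1)^d` is divisible by `Z^d`, so only `d ≤ n` contribute, and each binomial coefficient is
a polynomial in `a`. -/
lemma exists_polynomial_coeff_seriesPow (f : PowerSeries CobField)
    (hf : PowerSeries.constantCoeff f = 1) (n : ℕ) :
    ∃ P : Polynomial CobField, ∀ a, P.eval a = PowerSeries.coeff n (seriesPow f a) := by
  choose P hP using exists_polynomial_choose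
  refine ⟨∑ d ∈ Finset.range (n + 1), P d * Polynomial.C (PowerSeries.coeff n ((f - 1) ^ d)),
    fun a => ?_⟩
  have hs : PowerSeries.HasSubst (f - 1) :=
    PowerSeries.HasSubst.of_constantCoeff_zero' (by simp [hf])
  rw [seriesPow, PowerSeries.coeff_subst' hs, finsum_eq_sum_of_support_subset
    (s := Finset.range (n + 1))]
  · simp [Polynomial.eval_finsetSum, hP]
  · intro d hd
    by_contra hd'
    apply hd
    have hlt : n < d := by simpa using hd'
    have : PowerSeries.coeff n ((f - 1) ^ d) = 0 := by
      obtain ⟨g, hg⟩ := PowerSeries.X_dvd_iff.2 (show PowerSeries.constantCoeff (f - 1) = 0 by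
        simp [hf])
      rw [hg, mul_pow, PowerSeries.coeff_X_pow_mul', if_neg (by omega)]
    simp [this]

lemma exists_polynomial_coeff_seriesPow_mul (f g : PowerSeries CobField)
    (hf : PowerSeries.constantCoeff f = 1) (n : ℕ) :
    ∃ P : Polynomial CobField, ∀ a,
      P.eval a = PowerSeries.coeff n (seriesPow f (a / 2 - 1) * g) := by
  choose P hP using exists_polynomial_coeff_seriesPow f hf
  refine ⟨∑ p ∈ Finset.HasAntidiagonal.antidiagonal n, (P p.1).comp
    (Polynomial.C (1 / 2) * Polynomial.X - 1) * Polynomial.C (PowerSeries.coeff p.2 g),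
    fun a => ?_⟩
  rw [PowerSeries.coeff_mul, Polynomial.eval_finsetSum]
  refine Finset.sum_congr rfl fun p _ => ?_
  rw [Polynomial.eval_mul, Polynomial.eval_C, Polynomial.eval_comp, ← hP]
  congr 2
  simp
  ring

lemma eq_of_eval_natCast_eq {K : Type*} [Field K] [CharZero K] (P Q : Polynomial K) (N : ℕ)
    (hN : N ≠ 0) (h : ∀ q : ℕ, q ≠ 0 → N ∣ q → P.eval (q : K) = Q.eval (q : K)) : P = Q := by
  apply Polynomial.eq_of_infinite_eval_eq
  refine Set.infinite_of_injective_forall_mem (f := fun k : ℕ => ((N * (k + 1) : ℕ) : K)) ?_ ?_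
  · intro a b hab
    have := Nat.eq_of_mul_eq_mul_left (Nat.pos_of_ne_zero hN) (Nat.cast_injective hab)
    omega
  · intro k
    exact h _ (by positivity) (dvd_mul_right _ _)

/-- It suffices to compare a coboundary polynomial with a given polynomial at the sufficiently
divisible positive integers. -/
lemma countPoly_eval_eq {n : ℕ} {Λ : AddSubgroup (Fin n → ℤ)} {A : Finset (Fin n → ℤ)}
    (hA : ∀ a ∈ A, a ∈ Λ) (y : CobField) (P : Polynomial CobField)
    (h : ∀ k : ℕ, k ≠ 0 → (∀ B ∈ A.powerset, intMult Λ (B : Set (Fin n → ℤ)) ∣ 2 * k) →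
      (countPoly Λ A y).eval ((2 * k : ℕ) : CobField) = P.eval ((2 * k : ℕ) : CobField))
    (x : CobField) : (countPoly Λ A y).eval x = P.eval x := by
  congr 1
  -- Multiples of this number are divisible by every `m(B)`; the factor 2 makes `q` even, which
  -- fixes the number of residues with `-g = g`.
  refine eq_of_eval_natCast_eq _ _ (2 * ∏ B ∈ A.powerset, intMult Λ (B : Set (Fin n → ℤ))) ?_ ?_
  · refine mul_ne_zero two_ne_zero (Finset.prod_ne_zero_iff.2 fun B hB => intMult_ne_zero ?_)
    exact fun b hb => hA b (Finset.mem_powerset.1 hB hb)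
  · rintro q hq ⟨c, rfl⟩
    rw [mul_assoc] at hq ⊢
    refine h _ (right_ne_zero_of_mul hq) fun B hB => ?_
    exact ((Finset.dvd_prod_of_mem _ hB).mul_right _).mul_left _

lemma constantCoeff_deformedExp (c β : CobField) :
    PowerSeries.constantCoeff (deformedExp c β) = 1 := by
  rw [← PowerSeries.coeff_zero_eq_constantCoeff_apply, deformedExp, PowerSeries.coeff_mk]
  simp

lemma constantCoeff_seriesPow (f : PowerSeries CobField) (hf : PowerSeries.constantCoeff f = 1)
    (a : CobField) : PowerSeries.constantCoeff (seriesPow f a) = 1 := by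
  have hs : PowerSeries.HasSubst (f - 1) :=
    PowerSeries.HasSubst.of_constantCoeff_zero' (by simp [hf])
  rw [← PowerSeries.coeff_zero_eq_constantCoeff_apply, seriesPow, PowerSeries.coeff_subst' hs,
    finsum_eq_single _ 0]
  · simp
  · intro d hd
    simp [hf, hd]

/-! ### Integral root systems -/

/-- The standard basis vector of `ℤⁿ`. -/
def stdInt {n : ℕ} (i : Fin n) : Fin n → ℤ := Pi.single i 1

lemma intVec_stdInt {n : ℕ} (i : Fin n) : intVec n (stdInt i) = stdVec i := by
  ext j
  by_cases h : j = i
  · subst h; simp [stdInt, stdVec]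
  · simp [stdInt, stdVec, h]

lemma zmodPairing_stdInt {n m : ℕ} (x : Fin n → ZMod m) (i : Fin n) :
    zmodPairing x (stdInt i) = x i := by
  simp [zmodPairing, stdInt, Pi.single_apply]

/-- The integer vectors `e_i - e_j`, `i < j`. -/
def diffRoots (n : ℕ) : Finset (Fin n → ℤ) :=
  (ltPairs n).image fun p => stdInt p.1 - stdInt p.2

/-- The integer vectors `e_i + e_j`, `i < j`. -/
def sumRoots (n : ℕ) : Finset (Fin n → ℤ) :=
  (ltPairs n).image fun p => stdInt p.1 + stdInt p.2

/-- The integer vectors `c e_i`. -/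
def axisRoots (n : ℕ) (c : ℤ) : Finset (Fin n → ℤ) :=
  Finset.univ.image fun i => c • stdInt i

lemma mem_ltPairs {n : ℕ} {p : Fin n × Fin n} : p ∈ ltPairs n ↔ p.1 < p.2 := by
  simp [ltPairs]

lemma prod_diffRoots {n : ℕ} (f : (Fin n → ℤ) → CobField) :
    ∏ a ∈ diffRoots n, f a = ∏ p ∈ ltPairs n, f (stdInt p.1 - stdInt p.2) := by
  refine Finset.prod_image ?_
  rintro ⟨i, j⟩ hij ⟨k, l⟩ hkl h
  simp only [Finset.mem_coe, mem_ltPairs] at hij hkl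
  have h1 := congrFun h i
  have h2 := congrFun h j
  simp only [stdInt, Pi.sub_apply, Pi.single_apply] at h1 h2
  simp only [Prod.mk.injEq]
  constructor <;> grind

lemma prod_sumRoots {n : ℕ} (f : (Fin n → ℤ) → CobField) :
    ∏ a ∈ sumRoots n, f a = ∏ p ∈ ltPairs n, f (stdInt p.1 + stdInt p.2) := by
  refine Finset.prod_image ?_
  rintro ⟨i, j⟩ hij ⟨k, l⟩ hkl h
  simp only [Finset.mem_coe, mem_ltPairs] at hij hkl
  have h1 := congrFun h i
  have h2 := congrFun h j
  have h3 := congrFun h k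
  have h4 := congrFun h l
  simp only [stdInt, Pi.add_apply, Pi.single_apply] at h1 h2 h3 h4
  simp only [Prod.mk.injEq]
  constructor <;> grind

lemma prod_axisRoots {n : ℕ} {c : ℤ} (hc : c ≠ 0) (f : (Fin n → ℤ) → CobField) :
    ∏ a ∈ axisRoots n c, f a = ∏ i, f (c • stdInt i) := by
  refine Finset.prod_image ?_
  intro i _ j _ h
  have h1 := congrFun h i
  simp only [stdInt, Pi.smul_apply, Pi.single_apply] at h1
  by_contra hij
  simp [hij] at h1
  exact hc h1

lemma disjoint_diffRoots_sumRoots (n : ℕ) : Disjoint (diffRoots n) (sumRoots n) := by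
  rw [Finset.disjoint_left]
  intro a ha hb
  obtain ⟨⟨i, j⟩, hij, rfl⟩ := Finset.mem_image.1 ha
  obtain ⟨⟨k, l⟩, hkl, h⟩ := Finset.mem_image.1 hb
  simp only [mem_ltPairs] at hij hkl
  have h1 := congrFun h j
  simp only [stdInt, Pi.add_apply, Pi.sub_apply, Pi.single_apply] at h1
  grind

lemma disjoint_union_axisRoots (n : ℕ) (c : ℤ) (hc : 0 < c) :
    Disjoint (diffRoots n ∪ sumRoots n) (axisRoots n c) := by
  rw [Finset.disjoint_left]
  intro a ha hb
  obtain ⟨k, -, h⟩ := Finset.mem_image.1 hb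
  rcases Finset.mem_union.1 ha with ha | ha
  · obtain ⟨⟨i, j⟩, hij, rfl⟩ := Finset.mem_image.1 ha
    simp only [mem_ltPairs] at hij
    have h1 := congrFun h j
    simp only [stdInt, Pi.smul_apply, Pi.sub_apply, Pi.single_apply, smul_eq_mul] at h1
    grind
  · obtain ⟨⟨i, j⟩, hij, rfl⟩ := Finset.mem_image.1 ha
    simp only [mem_ltPairs] at hij
    have h1 := congrFun h j
    have h2 := congrFun h i
    simp only [stdInt, Pi.smul_apply, Pi.add_apply, Pi.single_apply, smul_eq_mul] at h1 h2
    grind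

/-- The lattice of integer vectors with even coordinate sum. -/
def evenLattice (n : ℕ) : AddSubgroup (Fin n → ℤ) :=
  (zmodPairing (fun _ : Fin n => (1 : ZMod 2))).ker

lemma mem_evenLattice {n : ℕ} {z : Fin n → ℤ} : z ∈ evenLattice n ↔ 2 ∣ ∑ i, z i := by
  rw [evenLattice, AddMonoidHom.mem_ker]
  simp only [zmodPairing, AddMonoidHom.coe_mk, ZeroHom.coe_mk, one_mul]
  rw [← Int.cast_sum, ZMod.intCast_zmod_eq_zero_iff_dvd]
  rfl

instance (n : ℕ) : (evenLattice n).FiniteIndex :=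
  inferInstanceAs (AddMonoidHom.ker _).FiniteIndex

lemma index_evenLattice {n : ℕ} (hn : n ≠ 0) : (evenLattice n).index = 2 := by
  rw [evenLattice, AddSubgroup.index_ker, AddMonoidHom.range_eq_top.2]
  · simp
  · intro y
    refine ⟨(y.val : ℤ) • stdInt ⟨0, Nat.pos_of_ne_zero hn⟩, ?_⟩
    rw [map_zsmul, zmodPairing_stdInt]
    simp

lemma sum_stdInt {n : ℕ} (i : Fin n) : ∑ k, stdInt i k = 1 := by
  simp [stdInt, Pi.single_apply]

lemma stdInt_sub_mem {n : ℕ} {H : AddSubgroup (Fin n → ℤ)} (hd : ∀ a ∈ diffRoots n, a ∈ H)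
    (i j : Fin n) : stdInt i - stdInt j ∈ H := by
  rcases lt_trichotomy i j with h | rfl | h
  · exact hd _ (Finset.mem_image.2 ⟨(i, j), mem_ltPairs.2 h, rfl⟩)
  · simp
  · rw [← neg_sub]
    exact H.neg_mem (hd _ (Finset.mem_image.2 ⟨(j, i), mem_ltPairs.2 h, rfl⟩))

/-- Modulo the differences `e_i - e_j`, a vector is determined by its coordinate sum. All root
lattices below are computed from this. -/
lemma mem_of_sum_smul_mem {n : ℕ} {H : AddSubgroup (Fin n → ℤ)} (hd : ∀ a ∈ diffRoots n, a ∈ H)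
    (i₀ : Fin n) (z : Fin n → ℤ) (hz : (∑ i, z i) • stdInt i₀ ∈ H) : z ∈ H := by
  have : z = ∑ i, z i • (stdInt i - stdInt i₀) + (∑ i, z i) • stdInt i₀ := by
    simp only [smul_sub, Finset.sum_sub_distrib, Finset.sum_smul, sub_add_cancel]
    ext j
    simp [stdInt, Finset.sum_apply, Pi.single_apply]
  rw [this]
  exact H.add_mem (H.sum_mem fun i _ => H.zsmul_mem (stdInt_sub_mem hd _ _) _) hz

open Classical in
/-- If `A` generates the part of `Λ` in its real span, its coboundary polynomial in the root lattice
is computed by `countPoly`. -/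
lemma cX_pow_mul_rootCoboundary_of_closure {n : ℕ} (Λ : AddSubgroup (Fin n → ℤ))
    (A : Finset (Fin n → ℤ)) (Φ : Finset (Fin n → ℝ)) (hΦ : Φ = A.image (intVec n))
    (hA : ∀ a ∈ A, a ∈ Λ)
    (hΛ : ∀ z ∈ Λ, intVec n z ∈ Submodule.span ℝ (intVec n '' A) →
      z ∈ AddSubgroup.closure (A : Set (Fin n → ℤ))) :
    cX ^ (n - Module.finrank ℤ
      (AddSubgroup.toIntSubmodule (AddSubgroup.closure (A : Set (Fin n → ℤ)))))
      * rootCoboundary Φ = (countPoly Λ A cY).eval cX := by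
  have hcoe : (Φ : Set (Fin n → ℝ)) = intVec n '' A := by rw [hΦ, Finset.coe_image]
  rw [finrank_closure_eq_intRank, intRank, ← hcoe]
  refine cX_pow_mul_rootCoboundary Λ A Φ hΦ fun v hv => ?_
  rw [rootLattice, hcoe, ← AddMonoidHom.map_closure]
  constructor
  · rintro ⟨z, hz, rfl⟩
    exact ⟨z, (AddSubgroup.closure_le Λ).2 hA hz, rfl⟩
  · rintro ⟨z, hz, rfl⟩
    exact ⟨z, hΛ z hz (hcoe ▸ hv), rfl⟩

lemma rootCoboundary_of_closure_eq {n : ℕ} (Λ : AddSubgroup (Fin n → ℤ)) [Λ.FiniteIndex]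
    (A : Finset (Fin n → ℤ)) (Φ : Finset (Fin n → ℝ)) (hΦ : ∀ v, v ∈ Φ ↔ ∃ a ∈ A, intVec n a = v)
    (hA : AddSubgroup.closure (A : Set (Fin n → ℤ)) = Λ) :
    rootCoboundary Φ = (countPoly Λ A cY).eval cX := by
  classical
  have := cX_pow_mul_rootCoboundary_of_closure Λ A Φ (by ext v; simp [hΦ])
    (fun a ha => hA ▸ AddSubgroup.subset_closure ha) (fun z hz _ => hA ▸ hz)
  rw [hA] at this
  have hr : Module.finrank ℤ (AddSubgroup.toIntSubmodule Λ) = n := finrank_of_finiteIndex Λ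
  rw [hr] at this
  simpa using this

lemma mem_diffRoots {n : ℕ} {a : Fin n → ℤ} :
    a ∈ diffRoots n ↔ ∃ i j : Fin n, i < j ∧ stdInt i - stdInt j = a := by
  simp [diffRoots, mem_ltPairs]

lemma mem_sumRoots {n : ℕ} {a : Fin n → ℤ} :
    a ∈ sumRoots n ↔ ∃ i j : Fin n, i < j ∧ stdInt i + stdInt j = a := by
  simp [sumRoots, mem_ltPairs]

lemma mem_axisRoots {n : ℕ} {c : ℤ} {a : Fin n → ℤ} :
    a ∈ axisRoots n c ↔ ∃ i : Fin n, c • stdInt i = a := by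
  simp [axisRoots]

lemma exists_mem_union_iff {α : Type*} [DecidableEq α] {s t : Finset α} {p : α → Prop} :
    (∃ a ∈ s ∪ t, p a) ↔ (∃ a ∈ s, p a) ∨ ∃ a ∈ t, p a := by
  simp only [Finset.mem_union, or_and_right, exists_or]

lemma exists_mem_diffRoots {n : ℕ} {v : Fin n → ℝ} :
    (∃ a ∈ diffRoots n, intVec n a = v) ↔ ∃ p ∈ ltPairs n, stdVec p.1 - stdVec p.2 = v := by
  simp [diffRoots, intVec_stdInt]

lemma exists_mem_sumRoots {n : ℕ} {v : Fin n → ℝ} :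
    (∃ a ∈ sumRoots n, intVec n a = v) ↔ ∃ p ∈ ltPairs n, stdVec p.1 + stdVec p.2 = v := by
  simp [sumRoots, intVec_stdInt]

lemma exists_mem_axisRoots {n : ℕ} {c : ℤ} {v : Fin n → ℝ} :
    (∃ a ∈ axisRoots n c, intVec n a = v) ↔ ∃ i : Fin n, (c : ℝ) • stdVec i = v := by
  simp only [axisRoots, Finset.mem_image, Finset.mem_univ, true_and, exists_exists_eq_and,
    map_zsmul, intVec_stdInt, Int.cast_smul_eq_zsmul]

lemma mem_posRootsA {n : ℕ} (v : Fin n → ℝ) :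
    v ∈ posRootsA n ↔ ∃ a ∈ diffRoots n, intVec n a = v := by
  rw [exists_mem_diffRoots]
  simp [posRootsA]

lemma mem_posRootsD {n : ℕ} (v : Fin n → ℝ) :
    v ∈ posRootsD n ↔ ∃ a ∈ diffRoots n ∪ sumRoots n, intVec n a = v := by
  rw [exists_mem_union_iff, exists_mem_diffRoots, exists_mem_sumRoots]
  simp [posRootsD]

lemma mem_posRootsB {n : ℕ} (v : Fin n → ℝ) :
    v ∈ posRootsB n ↔ ∃ a ∈ diffRoots n ∪ sumRoots n ∪ axisRoots n 1, intVec n a = v := by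
  rw [exists_mem_union_iff, exists_mem_union_iff, exists_mem_diffRoots, exists_mem_sumRoots,
    exists_mem_axisRoots]
  simp [posRootsB, or_assoc]

lemma mem_posRootsC {n : ℕ} (v : Fin n → ℝ) :
    v ∈ posRootsC n ↔ ∃ a ∈ diffRoots n ∪ sumRoots n ∪ axisRoots n 2, intVec n a = v := by
  rw [exists_mem_union_iff, exists_mem_union_iff, exists_mem_diffRoots, exists_mem_sumRoots,
    exists_mem_axisRoots]
  simp [posRootsC, or_assoc]

lemma diffRoots_subset_evenLattice {n : ℕ} : ∀ a ∈ diffRoots n, a ∈ evenLattice n := by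
  intro a ha
  obtain ⟨i, j, -, rfl⟩ := mem_diffRoots.1 ha
  rw [mem_evenLattice]
  simp [Finset.sum_sub_distrib, sum_stdInt]

lemma sumRoots_subset_evenLattice {n : ℕ} : ∀ a ∈ sumRoots n, a ∈ evenLattice n := by
  intro a ha
  obtain ⟨i, j, -, rfl⟩ := mem_sumRoots.1 ha
  rw [mem_evenLattice]
  simp [Finset.sum_add_distrib, sum_stdInt]

lemma axisRoots_subset_evenLattice {n : ℕ} : ∀ a ∈ axisRoots n 2, a ∈ evenLattice n := by
  intro a ha
  obtain ⟨i, rfl⟩ := mem_axisRoots.1 ha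
  rw [mem_evenLattice]
  simp [← Finset.mul_sum, sum_stdInt]

lemma posRootsC_subset_evenLattice {n : ℕ} :
    ∀ a ∈ diffRoots n ∪ sumRoots n ∪ axisRoots n 2, a ∈ evenLattice n := by
  simp only [Finset.mem_union]
  rintro a ((h | h) | h)
  exacts [diffRoots_subset_evenLattice a h, sumRoots_subset_evenLattice a h,
    axisRoots_subset_evenLattice a h]

lemma posRootsD_subset_evenLattice {n : ℕ} :
    ∀ a ∈ diffRoots n ∪ sumRoots n, a ∈ evenLattice n :=
  fun a ha => posRootsC_subset_evenLattice a (Finset.mem_union_left _ ha)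

lemma closure_posRootsB (n : ℕ) :
    AddSubgroup.closure ((diffRoots n ∪ sumRoots n ∪ axisRoots n 1 : Finset _) : Set (Fin n → ℤ))
      = ⊤ := by
  rw [eq_top_iff]
  intro z _
  rcases isEmpty_or_nonempty (Fin n) with h | ⟨⟨i⟩⟩
  · rw [Subsingleton.elim z 0]
    exact zero_mem _
  · refine mem_of_sum_smul_mem (fun a ha => AddSubgroup.subset_closure (by simp [ha])) i z ?_
    refine AddSubgroup.zsmul_mem _ (AddSubgroup.subset_closure ?_) _
    rw [Finset.mem_coe, Finset.mem_union, mem_axisRoots]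
    exact Or.inr ⟨i, one_smul _ _⟩

lemma evenLattice_le {n : ℕ} {H : AddSubgroup (Fin n → ℤ)} (hd : ∀ a ∈ diffRoots n, a ∈ H)
    (i : Fin n) (hi : (2 : ℤ) • stdInt i ∈ H) : evenLattice n ≤ H := by
  intro z hz
  refine mem_of_sum_smul_mem hd i z ?_
  obtain ⟨c, hc⟩ := mem_evenLattice.1 hz
  rw [hc, mul_comm, mul_smul]
  exact H.zsmul_mem hi _

lemma closure_posRootsC {n : ℕ} (hn : n ≠ 0) :
    AddSubgroup.closure ((diffRoots n ∪ sumRoots n ∪ axisRoots n 2 : Finset _) : Set (Fin n → ℤ))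
      = evenLattice n := by
  refine le_antisymm ((AddSubgroup.closure_le _).2 posRootsC_subset_evenLattice) ?_
  refine evenLattice_le (fun a ha => AddSubgroup.subset_closure (by simp [ha]))
    ⟨0, Nat.pos_of_ne_zero hn⟩ (AddSubgroup.subset_closure ?_)
  rw [Finset.mem_coe, Finset.mem_union, mem_axisRoots]
  exact Or.inr ⟨_, rfl⟩

lemma closure_posRootsD {n : ℕ} (hn : 2 ≤ n) :
    AddSubgroup.closure ((diffRoots n ∪ sumRoots n : Finset _) : Set (Fin n → ℤ))
      = evenLattice n := by
  refine le_antisymm ((AddSubgroup.closure_le _).2 posRootsD_subset_evenLattice) ?_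
  have h01 : (⟨0, by omega⟩ : Fin n) < ⟨1, by omega⟩ := by simp
  refine evenLattice_le (fun a ha => AddSubgroup.subset_closure (by simp [ha])) ⟨0, by omega⟩ ?_
  have h : (2 : ℤ) • stdInt (⟨0, by omega⟩ : Fin n)
      = (stdInt ⟨0, by omega⟩ - stdInt ⟨1, by omega⟩)
        + (stdInt ⟨0, by omega⟩ + stdInt ⟨1, by omega⟩) := by
    rw [two_smul]
    abel
  rw [h]
  refine AddSubgroup.add_mem _ (AddSubgroup.subset_closure ?_) (AddSubgroup.subset_closure ?_)
  · exact Finset.mem_union_left _ (mem_diffRoots.2 ⟨_, _, h01, rfl⟩)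
  · exact Finset.mem_union_right _ (mem_sumRoots.2 ⟨_, _, h01, rfl⟩)

lemma rootCoboundary_posRootsB (n : ℕ) : rootCoboundary (posRootsB n)
    = (countPoly ⊤ (diffRoots n ∪ sumRoots n ∪ axisRoots n 1) cY).eval cX :=
  rootCoboundary_of_closure_eq _ _ _ mem_posRootsB (closure_posRootsB n)

lemma rootCoboundary_posRootsC {n : ℕ} (hn : n ≠ 0) : rootCoboundary (posRootsC n)
    = (countPoly (evenLattice n) (diffRoots n ∪ sumRoots n ∪ axisRoots n 2) cY).eval cX :=
  rootCoboundary_of_closure_eq _ _ _ mem_posRootsC (closure_posRootsC hn)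

/-- For `n = 1` there are no roots and the corank is 1, which is where the factor `cX` comes from;
for `n ≥ 2` the roots generate the even lattice, of full rank. -/
lemma rootCoboundary_posRootsD {n : ℕ} (hn : n ≠ 0) :
    (if n = 1 then cX else 1) * rootCoboundary (posRootsD n)
    = (countPoly (evenLattice n) (diffRoots n ∪ sumRoots n) cY).eval cX := by
  classical
  split_ifs with h
  · subst h
    have he : diffRoots 1 ∪ sumRoots 1 = ∅ := by
      have : ltPairs 1 = ∅ := by
        ext p
        simp [mem_ltPairs, Subsingleton.elim p.1 p.2]
      simp [diffRoots, sumRoots, this]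
    have := cX_pow_mul_rootCoboundary_of_closure (evenLattice 1) (diffRoots 1 ∪ sumRoots 1)
      (posRootsD 1) (by ext v; simp only [mem_posRootsD, Finset.mem_image])
      posRootsD_subset_evenLattice (by
        intro z _ hz
        simp only [he, Finset.coe_empty, Set.image_empty, Submodule.span_empty,
          Submodule.mem_bot] at hz
        rw [intVec_injective 1 (hz.trans (map_zero _).symm)]
        exact zero_mem _)
    have hr : Module.finrank ℤ (AddSubgroup.toIntSubmodule
        (AddSubgroup.closure ((∅ : Finset (Fin 1 → ℤ)) : Set (Fin 1 → ℤ)))) = 0 := by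
      rw [finrank_closure_eq_intRank, intRank]
      simp
    rw [← this, he, hr, Nat.sub_zero, pow_one]
  · rw [one_mul]
    exact rootCoboundary_of_closure_eq _ _ _ mem_posRootsD (closure_posRootsD (by omega))

/-- The sum of the coordinates of an integer vector. -/
def coordSum (n : ℕ) : (Fin n → ℤ) →ₗ[ℤ] ℤ := ∑ i, LinearMap.proj i

lemma coordSum_apply {n : ℕ} (z : Fin n → ℤ) : coordSum n z = ∑ i, z i := by
  simp [coordSum]

lemma closure_posRootsA {n : ℕ} (hn : n ≠ 0) :
    AddSubgroup.closure (diffRoots n : Set (Fin n → ℤ)) = (coordSum n).ker.toAddSubgroup := by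
  apply le_antisymm
  · rw [AddSubgroup.closure_le]
    intro a ha
    obtain ⟨i, j, -, rfl⟩ := mem_diffRoots.1 ha
    change coordSum n _ = 0
    rw [map_sub, coordSum_apply, coordSum_apply, sum_stdInt, sum_stdInt, sub_self]
  · intro z hz
    have hz' : coordSum n z = 0 := hz
    refine mem_of_sum_smul_mem (fun a ha => AddSubgroup.subset_closure ha)
      ⟨0, Nat.pos_of_ne_zero hn⟩ z ?_
    rw [← coordSum_apply, hz', zero_smul]
    exact zero_mem _

/-- The integer points of the span are the vectors of coordinate sum 0, which form the root lattice.
So `ℤⁿ` can serve as `Λ`, and the corank 1 yields the factor `cX`. -/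
lemma cX_mul_rootCoboundary_posRootsA {n : ℕ} (hn : n ≠ 0) :
    cX * rootCoboundary (posRootsA n) = (countPoly ⊤ (diffRoots n) cY).eval cX := by
  classical
  have hrank : Module.finrank ℤ (AddSubgroup.toIntSubmodule
      (AddSubgroup.closure (diffRoots n : Set (Fin n → ℤ)))) + 1 = n := by
    rw [closure_posRootsA hn]
    have h := Submodule.finrank_quotient_add_finrank (coordSum n).ker
    have hsurj : Function.Surjective (coordSum n) := by
      intro c
      refine ⟨c • stdInt ⟨0, Nat.pos_of_ne_zero hn⟩, ?_⟩
      rw [map_zsmul, coordSum_apply, sum_stdInt]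
      simp
    rw [((coordSum n).quotKerEquivOfSurjective hsurj).finrank_eq, Module.finrank_self,
      Module.finrank_fin_fun, add_comm] at h
    exact h
  have := cX_pow_mul_rootCoboundary_of_closure ⊤ (diffRoots n) (posRootsA n)
    (by ext v; simp only [mem_posRootsA, Finset.mem_image]) (fun _ _ => trivial) (by
      intro z _ hz
      rw [closure_posRootsA hn]
      let s : (Fin n → ℝ) →ₗ[ℝ] ℝ := ∑ i, LinearMap.proj i
      have hs : Submodule.span ℝ (intVec n '' diffRoots n) ≤ s.ker := by
        rw [Submodule.span_le]
        rintro _ ⟨a, ha, rfl⟩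
        have : coordSum n a = 0 := by
          have := AddSubgroup.subset_closure (k := (diffRoots n : Set (Fin n → ℤ))) ha
          rwa [closure_posRootsA hn] at this
        rw [coordSum_apply] at this
        simp [s, ← Int.cast_sum, this]
      have h1 : s (intVec n z) = 0 := hs hz
      change coordSum n z = 0
      rw [coordSum_apply]
      simp [s] at h1
      exact_mod_cast h1)
  rw [← this, show n - Module.finrank ℤ (AddSubgroup.toIntSubmodule
      (AddSubgroup.closure (diffRoots n : Set (Fin n → ℤ)))) = 1 by omega, pow_one]

/-- For constant terms in types C and D: the even lattice has index 1, not 2, when `n = 0`. -/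
lemma rootCoboundary_of_fin_zero (Φ : Finset (Fin 0 → ℝ)) (hΦ : Φ = ∅) : rootCoboundary Φ = 1 := by
  subst hΦ
  have h : latticeMult (rootLattice (∅ : Finset (Fin 0 → ℝ))) ∅ = 1 := by
    rw [latticeMult, AddSubgroup.relIndex_eq_one]
    intro x _
    rw [Subsingleton.elim x 0]
    exact zero_mem _
  simp [rootCoboundary, arithCoboundary_eq, h]

/-! ### Counting over `ℤ/q`: types A and B -/

lemma zmodPairing_sub_eq_zero {n m : ℕ} (x : Fin n → ZMod m) (i j : Fin n) :
    zmodPairing x (stdInt i - stdInt j) = 0 ↔ x i = x j := by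
  rw [map_sub, zmodPairing_stdInt, zmodPairing_stdInt, sub_eq_zero]

lemma zmodPairing_add_eq_zero {n m : ℕ} (x : Fin n → ZMod m) (i j : Fin n) :
    zmodPairing x (stdInt i + stdInt j) = 0 ↔ x i = -x j := by
  rw [map_add, zmodPairing_stdInt, zmodPairing_stdInt, add_eq_zero_iff_eq_neg]

lemma prod_posRootsA_zmodPairing {n m : ℕ} (x : Fin n → ZMod m) (y : CobField) :
    ∏ a ∈ diffRoots n, (if zmodPairing x a = 0 then y else 1)
      = ∏ p ∈ ltPairs n, if x p.1 = x p.2 then y else 1 := by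
  simp only [prod_diffRoots, zmodPairing_sub_eq_zero]

lemma prod_posRootsD_zmodPairing {n m : ℕ} (x : Fin n → ZMod m) (y : CobField) :
    ∏ a ∈ diffRoots n ∪ sumRoots n, (if zmodPairing x a = 0 then y else 1)
      = ∏ p ∈ ltPairs n, (if x p.1 = x p.2 then y else 1) * if x p.1 = -x p.2 then y else 1 := by
  rw [Finset.prod_union (disjoint_diffRoots_sumRoots n)]
  simp only [prod_diffRoots, prod_sumRoots, zmodPairing_sub_eq_zero, zmodPairing_add_eq_zero,
    Finset.prod_mul_distrib]

lemma prod_union_axisRoots_zmodPairing {n m : ℕ} {c : ℤ} (hc : 0 < c) (x : Fin n → ZMod m)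
    (y : CobField) :
    ∏ a ∈ diffRoots n ∪ sumRoots n ∪ axisRoots n c, (if zmodPairing x a = 0 then y else 1)
      = (∏ p ∈ ltPairs n, (if x p.1 = x p.2 then y else 1) * if x p.1 = -x p.2 then y else 1)
        * ∏ i, if c • x i = 0 then y else 1 := by
  rw [Finset.prod_union (disjoint_union_axisRoots n c hc), prod_posRootsD_zmodPairing]
  simp only [prod_axisRoots hc.ne', map_zsmul, zmodPairing_stdInt]

open Classical in
/-- The finite field method for the full integer lattice. -/
lemma countPoly_top_eval {n : ℕ} (A : Finset (Fin n → ℤ)) (y : CobField) (q : ℕ) [NeZero q]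
    (hq : ∀ B ∈ A.powerset, intMult ⊤ (B : Set (Fin n → ℤ)) ∣ q) :
    (countPoly ⊤ A y).eval (q : CobField)
      = ∑ x : Fin n → ZMod q, ∏ a ∈ A, (if zmodPairing x a = 0 then y else 1) := by
  have h := sum_prod_zmodPairing ⊤ A (fun _ _ => trivial) y q q
    (fun x => ⟨x, trivial, rfl⟩) hq
  rw [AddSubgroup.index_top, Nat.cast_one, one_mul] at h
  rw [← h]
  refine Finset.sum_congr rfl fun x _ => ?_
  rw [if_pos]
  rintro _ ⟨z, -, rfl⟩
  rw [AddMonoidHom.mem_ker, nsmulAddMonoidHom_apply, map_nsmul, nsmul_eq_mul, ZMod.natCast_self,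
    zero_mul]

/-- At `X = q` the `q` residues are independent colours, each contributing `F(Z, Y)`. -/
lemma PsiRA_eq : PsiRA = seriesPow (deformedExp 1 cY) cX := by
  have hF := constantCoeff_deformedExp 1 cY
  ext n
  rcases eq_or_ne n 0 with rfl | hn
  · have h0 := constantCoeff_seriesPow _ hF cX
    rw [← PowerSeries.coeff_zero_eq_constantCoeff_apply] at h0
    rw [h0, PsiRA, map_add, PowerSeries.coeff_C_mul, PowerSeries.coeff_mk]
    simp
  · obtain ⟨P, hP⟩ := exists_polynomial_coeff_seriesPow _ hF n
    have hn! : (n.factorial : CobField) ≠ 0 := Nat.cast_ne_zero.2 (Nat.factorial_ne_zero _)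
    have key := countPoly_eval_eq (Λ := ⊤) (A := diffRoots n) (fun _ _ => trivial) cY
      (Polynomial.C (n.factorial : CobField) * P) (by
        intro k hk hdvd
        have : NeZero (2 * k) := ⟨by omega⟩
        rw [countPoly_top_eval _ _ _ hdvd, Polynomial.eval_mul, Polynomial.eval_C, hP,
          seriesPow_natCast _ hF]
        have := factorial_mul_coeff_prod_deformedExp (fun _ : ZMod (2 * k) => 1) (fun _ => cY) n
        rw [Finset.prod_const, Finset.card_univ, ZMod.card] at this
        rw [this]
        simp only [prod_posRootsA_zmodPairing, Finset.prod_const_one, one_mul]) cX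
    rw [← cX_mul_rootCoboundary_posRootsA hn, Polynomial.eval_mul, Polynomial.eval_C, hP] at key
    rw [PsiRA, map_add, PowerSeries.coeff_C_mul, PowerSeries.coeff_mk, if_neg hn,
      PowerSeries.coeff_one, if_neg hn, zero_add, mul_div_assoc', key]
    field_simp

lemma neg_eq_self_iff_zmod {k : ℕ} (hk : k ≠ 0) (g : ZMod (2 * k)) :
    -g = g ↔ g = 0 ∨ g = (k : ZMod (2 * k)) := by
  have : NeZero (2 * k) := ⟨by omega⟩
  have hkv : ((k : ZMod (2 * k))).val = k := ZMod.val_natCast_of_lt (by omega)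
  rw [ZMod.neg_eq_self_iff]
  refine or_congr_right ⟨fun h => ?_, ?_⟩
  · apply ZMod.val_injective
    omega
  · rintro rfl
    rw [hkv]

lemma natCast_half_ne_zero {k : ℕ} (hk : k ≠ 0) : (k : ZMod (2 * k)) ≠ 0 := by
  rw [Ne, ZMod.natCast_eq_zero_iff]
  intro h
  have := Nat.le_of_dvd (Nat.pos_of_ne_zero hk) h
  omega

/-- At `X = q = 2(l + 1)`, negation on `ℤ/q` fixes 0 and `l + 1` and has `l = q/2 - 1` free orbits.
The root `e_i` vanishes only on residue 0, so the fixed points have weights `Y` and 1. -/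
lemma PsiRB_eq : PsiRB = seriesPow (deformedExp 2 cY) (cX / 2 - 1)
      * deformedExp 1 (cY ^ 2) * deformedExp cY (cY ^ 2) := by
  have hF := constantCoeff_deformedExp 2 cY
  ext n
  rw [mul_assoc]
  obtain ⟨P, hP⟩ := exists_polynomial_coeff_seriesPow_mul _
    (deformedExp 1 (cY ^ 2) * deformedExp cY (cY ^ 2)) hF n
  have hn! : (n.factorial : CobField) ≠ 0 := Nat.cast_ne_zero.2 (Nat.factorial_ne_zero _)
  have key := countPoly_eval_eq (Λ := ⊤) (A := diffRoots n ∪ sumRoots n ∪ axisRoots n 1)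
    (fun _ _ => trivial) cY (Polynomial.C (n.factorial : CobField) * P) (by
      intro k hk hdvd
      have : NeZero (2 * k) := ⟨by omega⟩
      obtain ⟨l, rfl⟩ := Nat.exists_eq_succ_of_ne_zero hk
      have hfilter : (Finset.univ.filter fun g : ZMod (2 * (l + 1)) => -g = g)
          = {0, ((l + 1 : ℕ) : ZMod (2 * (l + 1)))} := by
        ext g
        simp only [Finset.mem_filter, Finset.mem_univ, true_and, neg_eq_self_iff_zmod hk,
          Finset.mem_insert, Finset.mem_singleton]
      have hne := natCast_half_ne_zero hk
      have hcard : (Finset.univ.filter fun g : ZMod (2 * (l + 1)) => -g ≠ g).card = 2 * l := by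
        have := Finset.card_filter_add_card_filter_not (s := Finset.univ)
          fun g : ZMod (2 * (l + 1)) => -g = g
        rw [hfilter, Finset.card_pair hne.symm, Finset.card_univ, ZMod.card] at this
        change 2 + (Finset.univ.filter fun g : ZMod (2 * (l + 1)) => -g ≠ g).card = _ at this
        omega
      have hsum := sum_involution (fun g : ZMod (2 * (l + 1)) => -g) neg_neg
        (fun g => if g = 0 then cY else 1) (by
          intro g hg
          refine if_neg ?_
          rintro rfl
          exact hg neg_zero) cY l hcard n
      rw [hfilter, Finset.prod_pair hne.symm, if_pos rfl, if_neg hne] at hsum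
      rw [countPoly_top_eval _ _ _ hdvd, Polynomial.eval_mul, Polynomial.eval_C, hP,
        show ((2 * (l + 1) : ℕ) : CobField) / 2 - 1 = (l : ℕ) by push_cast; ring,
        seriesPow_natCast _ hF, mul_comm (deformedExp 1 _), ← hsum]
      simp only [prod_union_axisRoots_zmodPairing one_pos, one_smul]) cX
  rw [← rootCoboundary_posRootsB, Polynomial.eval_mul, Polynomial.eval_C, hP] at key
  rw [PsiRB, PowerSeries.coeff_mk, key]
  field_simp

/-! ### Counting on the even lattice: types C and D -/

/-- Reduction of `ℤ/2q` to `ℤ/2`. -/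
def parity (q : ℕ) : ZMod (2 * q) →+* ZMod 2 := ZMod.castHom (dvd_mul_right 2 q) (ZMod 2)

lemma mul_eq_zero_iff_parity {q : ℕ} (hq : q ≠ 0) (y : ZMod (2 * q)) :
    (q : ZMod (2 * q)) * y = 0 ↔ parity q y = 0 := by
  have : NeZero (2 * q) := ⟨by omega⟩
  obtain ⟨k, rfl⟩ : ∃ k : ℕ, (k : ZMod (2 * q)) = y := ⟨y.val, ZMod.natCast_zmod_val y⟩
  rw [map_natCast, ZMod.natCast_eq_zero_iff, ← Nat.cast_mul, ZMod.natCast_eq_zero_iff,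
    mul_comm 2 q]
  exact Nat.mul_dvd_mul_iff_left (Nat.pos_of_ne_zero hq)

/-- A point of the torus annihilates `q E` exactly when its coordinates have the same parity. -/
lemma evenLattice_map_le_ker_iff {n q : ℕ} (hq : q ≠ 0) (x : Fin n → ZMod (2 * q)) (i₀ : Fin n) :
    (evenLattice n).map (nsmulAddMonoidHom q) ≤ (zmodPairing x).ker
      ↔ ∀ i, parity q (x i) = parity q (x i₀) := by
  have hmem : (evenLattice n).map (nsmulAddMonoidHom q) ≤ (zmodPairing x).ker
      ↔ ∀ z ∈ evenLattice n, parity q (zmodPairing x z) = 0 := by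
    rw [AddSubgroup.map_le_iff_le_comap]
    refine forall₂_congr fun z _ => ?_
    rw [AddSubgroup.mem_comap, AddMonoidHom.mem_ker, nsmulAddMonoidHom_apply, map_nsmul,
      nsmul_eq_mul, mul_eq_zero_iff_parity hq]
  rw [hmem]
  constructor
  · intro h i
    have := h _ (stdInt_sub_mem diffRoots_subset_evenLattice i i₀)
    rwa [map_sub, map_sub, zmodPairing_stdInt, zmodPairing_stdInt, sub_eq_zero] at this
  · intro h z hz
    have hz' : ((∑ i, z i : ℤ) : ZMod 2) = 0 := by
      rw [ZMod.intCast_zmod_eq_zero_iff_dvd]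
      exact mem_evenLattice.1 hz
    simp only [zmodPairing, AddMonoidHom.coe_mk, ZeroHom.coe_mk, map_sum, map_mul, map_intCast, h]
    rw [← Finset.mul_sum, ← Int.cast_sum, hz', mul_zero]

lemma sum_same_parity {n q : ℕ} [NeZero q] (i₀ : Fin n)
    (w : (Fin n → ZMod (2 * q)) → CobField) :
    ∑ x : Fin n → ZMod (2 * q), (if ∀ i, parity q (x i) = parity q (x i₀) then w x else 0)
      = ∑ ε : ZMod 2, ∑ x : Fin n → {g : ZMod (2 * q) // parity q g = ε}, w fun i => x i := by
  have h1 (x : Fin n → ZMod (2 * q)) :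
      (if ∀ i, parity q (x i) = parity q (x i₀) then w x else 0)
        = ∑ ε : ZMod 2, if ∀ i, parity q (x i) = ε then w x else 0 := by
    rw [Finset.sum_eq_single (parity q (x i₀))]
    · intro ε _ hε
      rw [if_neg]
      exact fun h => hε (h i₀).symm
    · simp
  rw [Finset.sum_congr rfl fun x _ => h1 x, Finset.sum_comm]
  refine Finset.sum_congr rfl fun ε _ => ?_
  rw [← Finset.sum_filter]
  rw [← Finset.sum_subtype_eq_sum_filter]
  symm
  refine Finset.sum_equiv (Equiv.subtypePiEquivPi (p := fun (_ : Fin n) (g : ZMod (2 * q)) =>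
    parity q g = ε)).symm ?_ ?_
  · simp
  · intro x _
    rfl

lemma card_parity_fiber {q : ℕ} [NeZero q] (ε : ZMod 2) :
    Fintype.card {g : ZMod (2 * q) // parity q g = ε} = q := by
  have hsurj : Function.Surjective (parity q) := ZMod.castHom_surjective _
  have hcard (ε : ZMod 2) : Fintype.card {g : ZMod (2 * q) // parity q g = ε}
      = Fintype.card {g : ZMod (2 * q) // parity q g = 0} := by
    obtain ⟨a, ha⟩ := hsurj ε
    refine Fintype.card_congr ((Equiv.subRight a).subtypeEquiv fun g => ?_)
    simp [ha, sub_eq_zero]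
  have htot := Fintype.card_congr (Equiv.sigmaFiberEquiv (parity q))
  rw [Fintype.card_sigma, Finset.sum_congr rfl fun ε _ => hcard ε, Finset.sum_const,
    Finset.card_univ, ZMod.card, ZMod.card, smul_eq_mul] at htot
  rw [hcard]
  omega

/-- The contribution of one parity class to the signed count. -/
lemma sum_parity_class {n k : ℕ} [NeZero (2 * k)] (ε : ZMod 2) (u y : CobField) (l c : ℕ)
    (hc : Fintype.card {g : {g : ZMod (2 * (2 * k)) // parity (2 * k) g = ε} // -g.1 = g.1} = c)
    (hl : 2 * k = 2 * l + c) :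
    ∑ x : Fin n → {g : ZMod (2 * (2 * k)) // parity (2 * k) g = ε},
      (∏ p ∈ ltPairs n, (if (x p.1).1 = (x p.2).1 then y else 1)
        * (if (x p.1).1 = -(x p.2).1 then y else 1)) * ∏ i, (if -(x i).1 = (x i).1 then u else 1)
      = (n.factorial : CobField) * PowerSeries.coeff n (deformedExp 2 y ^ l
        * deformedExp u (y ^ 2) ^ c) := by
  let σ : {g : ZMod (2 * (2 * k)) // parity (2 * k) g = ε}
      → {g : ZMod (2 * (2 * k)) // parity (2 * k) g = ε} :=
    fun g => ⟨-g.1, by rw [map_neg, g.2, ZMod.neg_eq_self_mod_two]⟩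
  have hσ (g) : σ g = g ↔ -g.1 = g.1 := Subtype.ext_iff
  have hfix : (Finset.univ.filter fun g => σ g = g).card = c := by
    rw [← hc, Fintype.card_subtype]
    simp only [hσ]
  have hnon : (Finset.univ.filter fun g => σ g ≠ g).card = 2 * l := by
    have := Finset.card_filter_add_card_filter_not (s := Finset.univ) fun g => σ g = g
    rw [hfix, Finset.card_univ, card_parity_fiber] at this
    change c + (Finset.univ.filter fun g => σ g ≠ g).card = _ at this
    omega
  have h := sum_involution σ (fun g => Subtype.ext (neg_neg _))
    (fun g => if -g.1 = g.1 then u else 1) (fun g hg => if_neg fun h => hg ((hσ g).2 h))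
    y l hnon n
  rw [Finset.prod_congr rfl (g := fun _ => deformedExp u (y ^ 2)), Finset.prod_const, hfix] at h
  · rw [← h]
    simp only [Subtype.ext_iff, σ]
  · intro g hg
    rw [if_pos ((hσ g).1 (Finset.mem_filter.1 hg).2)]

/-- The residues of `ℤ/2q` fixed by negation are 0 and `q`. As `q = 2k` is even, both lie in the
even class and the odd class has none. -/
lemma card_fixed_even {k : ℕ} [NeZero (2 * k)] :
    Fintype.card {g : {g : ZMod (2 * (2 * k)) // parity (2 * k) g = 0} // -g.1 = g.1} = 2 := by
  have hq : 2 * k ≠ 0 := NeZero.ne _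
  have hpar : parity (2 * k) ((2 * k : ℕ) : ZMod (2 * (2 * k))) = 0 := by
    rw [map_natCast, ZMod.natCast_eq_zero_iff]
    exact dvd_mul_right _ _
  rw [Fintype.card_congr (Equiv.subtypeSubtypeEquivSubtypeInter
    (fun g : ZMod (2 * (2 * k)) => parity (2 * k) g = 0) fun g => -g = g), Fintype.card_subtype]
  refine Eq.trans (congrArg Finset.card ?_) (Finset.card_pair (natCast_half_ne_zero hq).symm)
  ext g
  simp only [Finset.mem_filter, Finset.mem_univ, true_and, neg_eq_self_iff_zmod hq,
    Finset.mem_insert, Finset.mem_singleton, and_iff_right_iff_imp]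
  rintro (rfl | rfl)
  · exact map_zero _
  · exact hpar

lemma card_fixed_odd {k : ℕ} [NeZero (2 * k)] :
    Fintype.card {g : {g : ZMod (2 * (2 * k)) // parity (2 * k) g = 1} // -g.1 = g.1} = 0 := by
  have hq : 2 * k ≠ 0 := NeZero.ne _
  rw [Fintype.card_eq_zero_iff]
  refine ⟨?_⟩
  rintro ⟨⟨g, hg⟩, h⟩
  rcases (neg_eq_self_iff_zmod hq g).1 h with rfl | rfl
  · rw [map_zero] at hg
    exact zero_ne_one hg
  · rw [map_natCast, (ZMod.natCast_eq_zero_iff _ _).2 (dvd_mul_right _ _)] at hg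
    exact zero_ne_one hg

/-- The coefficients of the generating functions attached to the even lattice. -/
lemma countPoly_evenLattice_eval {n : ℕ} (hn : n ≠ 0) (A : Finset (Fin n → ℤ))
    (hA : ∀ a ∈ A, a ∈ evenLattice n) (u : CobField)
    (hw : ∀ (q : ℕ) (x : Fin n → ZMod q),
      ∏ a ∈ A, (if zmodPairing x a = 0 then cY else 1)
      = (∏ p ∈ ltPairs n, (if x p.1 = x p.2 then cY else 1) * (if x p.1 = -x p.2 then cY else 1))
        * ∏ i, (if -x i = x i then u else 1)) :
    (countPoly (evenLattice n) A cY).eval cX = (n.factorial : CobField) * PowerSeries.coeff n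
      (PowerSeries.C (1 / 2 : CobField) * seriesPow (deformedExp 2 cY) (cX / 2 - 1)
      * (deformedExp 2 cY + deformedExp u (cY ^ 2) ^ 2)) := by
  classical
  have hF := constantCoeff_deformedExp 2 cY
  obtain ⟨P, hP⟩ := exists_polynomial_coeff_seriesPow_mul _
    (deformedExp 2 cY + deformedExp u (cY ^ 2) ^ 2) hF n
  -- The factor 1/2 is the inverse of the index of the even lattice in `ℤⁿ`.
  have key := countPoly_eval_eq (Λ := evenLattice n) (A := A) hA cY
    (Polynomial.C (n.factorial * (1 / 2) : CobField) * P) (by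
      intro k hk hdvd
      have : NeZero (2 * k) := ⟨by omega⟩
      have : NeZero (2 * (2 * k)) := ⟨by omega⟩
      obtain ⟨l, rfl⟩ := Nat.exists_eq_succ_of_ne_zero hk
      -- Modulus `2q` is enough: doubling any integer vector lands in the even lattice `E`, so `2q
      -- ℤⁿ ⊆ qE`.
      have h := sum_prod_zmodPairing (evenLattice n) A hA cY (2 * (2 * (l + 1))) (2 * (l + 1))
        (by
          intro x
          refine ⟨2 • x, ?_, ?_⟩
          · rw [SetLike.mem_coe, mem_evenLattice]
            simp [← Finset.mul_sum]
          · rw [nsmulAddMonoidHom_apply, smul_smul, mul_comm]) hdvd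
      let i₀ : Fin n := ⟨0, Nat.pos_of_ne_zero hn⟩
      have h2 : ∀ x : Fin n → ZMod (2 * (2 * (l + 1))),
          (evenLattice n).map (nsmulAddMonoidHom (2 * (l + 1))) ≤ (zmodPairing x).ker
          ↔ ∀ i, parity (2 * (l + 1)) (x i) = parity (2 * (l + 1)) (x i₀) :=
        fun x => evenLattice_map_le_ker_iff (NeZero.ne _) x i₀
      simp only [hw, h2] at h
      have h3 := sum_same_parity (q := 2 * (l + 1)) i₀ fun x =>
        (∏ p ∈ ltPairs n, (if x p.1 = x p.2 then cY else 1) * (if x p.1 = -x p.2 then cY else 1))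
        * ∏ i, (if -x i = x i then u else 1)
      have h4 := h.symm.trans (Eq.trans (Finset.sum_congr rfl fun x _ => by congr) h3)
      -- With `q = 2(l + 1)`, each class has `q` residues: the even one consists of `l` free orbits
      -- and 2 fixed points, the odd one of `l + 1` free orbits.
      rw [index_evenLattice hn, show (Finset.univ : Finset (ZMod 2)) = {0, 1} from rfl,
        Finset.sum_pair zero_ne_one,
        sum_parity_class 0 u cY l 2 card_fixed_even (by omega),
        sum_parity_class 1 u cY (l + 1) 0 card_fixed_odd (by omega), ← mul_add, ← map_add,
        pow_zero, mul_one, pow_succ (deformedExp 2 cY) l, ← mul_add, add_comm (_ ^ 2),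
        ← seriesPow_natCast _ hF,
        show (l : CobField) = ((2 * (l + 1) : ℕ) : CobField) / 2 - 1 by push_cast; ring,
        ← hP, Nat.cast_ofNat] at h4
      rw [Polynomial.eval_mul, Polynomial.eval_C]
      linear_combination (1 / 2 : CobField) * h4) cX
  rw [key, Polynomial.eval_mul, Polynomial.eval_C, hP, mul_assoc (PowerSeries.C _),
    PowerSeries.coeff_C_mul, mul_assoc]

lemma coeff_zero_rhs (u : CobField) : PowerSeries.coeff 0
      (PowerSeries.C (1 / 2 : CobField) * seriesPow (deformedExp 2 cY) (cX / 2 - 1)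
      * (deformedExp 2 cY + deformedExp u (cY ^ 2) ^ 2)) = 1 := by
  rw [PowerSeries.coeff_zero_eq_constantCoeff_apply]
  simp only [map_mul, map_add, map_pow, constantCoeff_deformedExp, PowerSeries.constantCoeff_C,
    constantCoeff_seriesPow _ (constantCoeff_deformedExp 2 cY)]
  norm_num

/-- The root `2e_i` vanishes exactly on the residues fixed by negation, so both fixed points carry
weight `Y`; in type D they carry weight 1. -/
lemma PsiRC_eq : PsiRC = PowerSeries.C (1 / 2 : CobField)
      * seriesPow (deformedExp 2 cY) (cX / 2 - 1)
      * (deformedExp 2 cY + deformedExp cY (cY ^ 2) ^ 2) := by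
  ext n
  rcases eq_or_ne n 0 with rfl | hn
  · rw [coeff_zero_rhs, PsiRC, PowerSeries.coeff_mk, rootCoboundary_of_fin_zero]
    · simp
    · ext v
      simp [posRootsC, ltPairs]
  · have key := countPoly_evenLattice_eval hn _ posRootsC_subset_evenLattice cY (fun q x => by
      rw [prod_union_axisRoots_zmodPairing two_pos]
      simp only [two_smul, neg_eq_iff_add_eq_zero])
    have hn! : (n.factorial : CobField) ≠ 0 := Nat.cast_ne_zero.2 (Nat.factorial_ne_zero _)
    rw [PsiRC, PowerSeries.coeff_mk, rootCoboundary_posRootsC hn, key, mul_div_cancel_left₀ _ hn!]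

lemma PsiRD_eq : PsiRD = PowerSeries.C (1 / 2 : CobField)
      * seriesPow (deformedExp 2 cY) (cX / 2 - 1)
      * (deformedExp 2 cY + deformedExp 1 (cY ^ 2) ^ 2) := by
  ext n
  rcases eq_or_ne n 0 with rfl | hn
  · rw [coeff_zero_rhs, PsiRD, PowerSeries.coeff_mk, rootCoboundary_of_fin_zero]
    · simp
    · ext v
      simp [posRootsD, ltPairs]
  · have key := countPoly_evenLattice_eval hn _ posRootsD_subset_evenLattice 1 (fun q x => by
      rw [prod_posRootsD_zmodPairing]
      simp only [ite_self, Finset.prod_const_one, mul_one])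
    have hn! : (n.factorial : CobField) ≠ 0 := Nat.cast_ne_zero.2 (Nat.factorial_ne_zero _)
    rw [PsiRD, PowerSeries.coeff_mk, rootCoboundary_posRootsD hn, key, mul_div_cancel_left₀ _ hn!]

end

theorem theorem1p9 :
    PsiRA = seriesPow (deformedExp 1 cY) cX ∧
    PsiRB = seriesPow (deformedExp 2 cY) (cX / 2 - 1)
      * deformedExp 1 (cY ^ 2) * deformedExp cY (cY ^ 2) ∧
    PsiRC = PowerSeries.C (1 / 2 : CobField) * seriesPow (deformedExp 2 cY) (cX / 2 - 1)
      * (deformedExp 2 cY + deformedExp cY (cY ^ 2) ^ 2) ∧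
    PsiRD = PowerSeries.C (1 / 2 : CobField) * seriesPow (deformedExp 2 cY) (cX / 2 - 1)
      * (deformedExp 2 cY + deformedExp 1 (cY ^ 2) ^ 2) :=
  ⟨PsiRA_eq, PsiRB_eq, PsiRC_eq, PsiRD_eq⟩
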